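/- Let $\mathbf{k}$ be a unitary commutative ring, $X$ a set, $\Omega$ a nonempty set disjoint from $X$, and $\lambda_\Omega=(\lambda_\omega)_{\omega\in\Omega}$ a family in $\mathbf{k}$. Algebras are unitary and associative over $\mathbf{k}$. **Algebras with operators.** An $\Omega$-operated algebra is an algebra $R$ with linear operators $P_\omega:R\to R$ ($\omega\in\Omega$); homomorphisms are algebra homomorphisms commuting with the operators. It is a matching Rota-Baxter algebra of weight $\lambda_\Omega$ if $$P_\alpha(x)P_\beta(y)=P_\alpha(xP_\beta(y))+P_\beta(P_\alpha(x)y)+\lambda_\beta P_\alpha(xy)\qquad(x,y\in R,\ \alpha,\beta\in\Omega).$$ Such an algebra $A$ with a map $j:X\to A$ is free on $X$ if for every matching Rota-Baxter algebra $R$ of weight $\lambda_\Omega$ and every map $f:X\to R$ there is a unique homomorphism $\bar f:A\to R$ with $\bar f j=f$. An $\Omega$-operated algebra is filtered by an increasing exhaustive sequence of submodules $(R_n)_{n\ge 0}$ if $1\in R_0$, $R_pR_q\subseteq R_{p+q}$ and $P_\omega(R_n)\subseteq R_{n+1}$; homomorphisms of $\Omega$-operated filtered algebras are the homomorphisms $\phi$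 with $\phi(R_n)\subseteq R'_n$ for all $n$. **Words and forests.** Let $\mathfrak{M}(X,\Omega)$ be the free $\Omega$-operated monoid on $X$, whose elements are the bracketed words, with the brackets $w\mapsto\lfloor w\rfloor_\omega$. Let $\mathcal{F}(X,\Omega)$ be the monoid, under concatenation, of planar rooted forests with vertices decorated by $X\sqcup\Omega$ such that elements of $X$ decorate leaves only, $B^+_\omega$ the operator grafting a forest on a new root decorated by $\omega$, and $\theta:\mathfrak{M}(X,\Omega)\to\mathcal{F}(X,\Omega)$ the isomorphism of monoids with $\theta(x)=\bullet_x$ and $\theta(\lfloor w\rfloor_\omega)=B^+_\omega(\theta(w))$. Extend all these maps linearly. Let $M(X)$ be the set of all words and $S(X)$ the set of all nonempty words in the letters $X$. Put $\mathfrak{X}_0=M(X)$ and $\mathfrak{X}_{n+1}=\Lambda(S(X),\mathfrak{X}_n)$, where, with $\lfloor Z\rfloor_\Omega=\{\lfloor z\rfloor_\omega: z\in Z,\omega\in\Omega\}$, $$\Lambda(Y,Z)=\bigcup_{r\ge1}(Y\lfloor Z\rfloor_\Omega)^r\cup\bigcup_{r\ge0}(Y\lfloor Z\rfloor_\Omega)^rY\cup\bigcup_{r\ge1}(\lfloor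 Z\rfloor_\Omega Y)^r\cup\bigcup_{r\ge0}(\lfloor Z\rfloor_\Omega Y)^r\lfloor Z\rfloor_\Omega\cup\{1\},$$ and let $\mathfrak{X}_\infty=\bigcup_n\mathfrak{X}_n$ and $\mathfrak{L}_\infty=\theta(\mathfrak{X}_\infty)$ (the matching Rota-Baxter forests). The bilinear product $\diamond$ on $\mathbf{k}\mathfrak{X}_\infty$ is defined recursively: $w\diamond w'=ww'$ if $w=1$ or $w'=1$; otherwise, writing $w=w_1\cdots w_m$ and $w'=w'_1\cdots w'_{m'}$ as products of elements of $X\cup\lfloor\mathfrak{X}_\infty\rfloor_\Omega$, $w\diamond w'=w_1\cdots w_{m-1}(w_m\diamond w'_1)w'_2\cdots w'_{m'}$, where $$\lfloor u\rfloor_\alpha\diamond\lfloor v\rfloor_\beta=\lfloor u\diamond\lfloor v\rfloor_\beta\rfloor_\alpha+\lfloor\lfloor u\rfloor_\alpha\diamond v\rfloor_\beta+\lambda_\beta\lfloor u\diamond v\rfloor_\alpha$$ and $w_m\diamond w'_1=w_mw'_1$ if $w_m\in X$ or $w'_1\in X$. On $\mathbf{k}\mathfrak{L}_\infty$ put $F\diamond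 F'=\theta(\theta^{-1}(F)\diamond\theta^{-1}(F'))$. Let $\mathrm{Id}(S)$ be the smallest ideal of $\mathbf{k}\mathfrak{M}(X,\Omega)$ that is stable under all brackets and contains all elements $\lfloor x\rfloor_\alpha\lfloor y\rfloor_\beta-\lfloor x\lfloor y\rfloor_\beta\rfloor_\alpha-\lfloor\lfloor x\rfloor_\alpha y\rfloor_\beta-\lambda_\beta\lfloor xy\rfloor_\alpha$ with $x,y\in\mathfrak{M}(X,\Omega)$ and $\alpha,\beta\in\Omega$. **Proposition.** 1. $(\mathbf{k}\mathfrak{L}_\infty,\diamond,(B^+_\omega)_{\omega\in\Omega})$, with the empty forest as unit and with $j_X:x\mapsto\bullet_x$, is the free matching Rota-Baxter algebra of weight $\lambda_\Omega$ on $X$. 2. It is an $\Omega$-operated filtered algebra with respect to the submodules $\mathbf{k}\mathfrak{L}_{(n)}$, $n\ge0$, where $\mathfrak{L}_{(n)}$ is the set of forests in $\mathfrak{L}_\infty$ with at most $n$ vertices. Likewise $\mathbf{k}\mathcal{F}(X,\Omega)$, with concatenation and the operators $B^+_\omega$, is an $\Omega$-operated filtered algebra with respect to the spans of the forests with at most $n$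 vertices. 3. $\mathbf{k}\mathfrak{M}(X,\Omega)=\mathrm{Id}(S)\oplus\mathbf{k}\mathfrak{X}_\infty$, and if $\varphi:\mathbf{k}\mathfrak{M}(X,\Omega)\to\mathbf{k}\mathfrak{X}_\infty$ denotes the projection along $\mathrm{Id}(S)$, then $\psi=\theta\varphi\theta^{-1}:\mathbf{k}\mathcal{F}(X,\Omega)\to\mathbf{k}\mathfrak{L}_\infty$ is a homomorphism of $\Omega$-operated filtered algebras. -/

import Mathlib

universe t u v w

open scoped Pointwise

namespace MatchingRB

/-! ### Operated algebras and matching Rota-Baxter algebras -/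

/-- Raw data on a `k`-module `A`: a bilinear product, a distinguished element, and a family
of linear operators indexed by `Ω`. The axioms are the predicates below. -/
structure OperatedData (k Ω A : Type*) [CommRing k] [AddCommGroup A] [Module k A] where
  mul : A →ₗ[k] A →ₗ[k] A
  one : A
  op : Ω → A →ₗ[k] A

/-- A unitary associative `k`-algebra `A` (in the sense of Mathlib) together with a family
of `k`-linear operators. -/
def OperatedData.ofAlgebra {k Ω A : Type*} [CommRing k] [Ring A] [Algebra k A]
    (P : Ω → A →ₗ[k] A) : OperatedData k Ω A where
  mul := LinearMap.mul k A
  one := 1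
  op := P

section Predicates

variable {k Ω A B : Type*} [CommRing k] [AddCommGroup A] [Module k A]
  [AddCommGroup B] [Module k B]

/-- The product is associative and unital: the data form an `Ω`-operated algebra. -/
structure IsOperatedAlgebra (D : OperatedData k Ω A) : Prop where
  one_mul : ∀ a, D.mul D.one a = a
  mul_one : ∀ a, D.mul a D.one = a
  mul_assoc : ∀ a b c, D.mul (D.mul a b) c = D.mul a (D.mul b c)

/-- A matching Rota-Baxter algebra of weight `lam`. -/
structure IsMatchingRotaBaxter (lam : Ω → k) (D : OperatedData k Ω A) : Prop
    extends IsOperatedAlgebra D where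
  rota_baxter : ∀ (α β : Ω) (x y : A),
    D.mul (D.op α x) (D.op β y) =
      D.op α (D.mul x (D.op β y)) + D.op β (D.mul (D.op α x) y) + lam β • D.op α (D.mul x y)

/-- Homomorphisms of operated algebras (equivalently, of matching Rota-Baxter algebras):
linear maps preserving product, unit and operators. -/
structure IsOperatedHom (D : OperatedData k Ω A) (E : OperatedData k Ω B)
    (φ : A →ₗ[k] B) : Prop where
  map_mul : ∀ a b, φ (D.mul a b) = E.mul (φ a) (φ b)
  map_one : φ D.one = E.one
  map_op : ∀ ω a, φ (D.op ω a) = E.op ω (φ a)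

/-- `D` with `j : X → A` is the free matching Rota-Baxter algebra of weight `lam` on `X`. -/
def IsFreeMatchingRotaBaxter.{r, u₁, u₂, u₃, u₄} {k : Type u₁} {Ω : Type u₂} {A : Type u₃}
    {X : Type u₄} [CommRing k] [AddCommGroup A] [Module k A]
    (lam : Ω → k) (D : OperatedData k Ω A) (j : X → A) : Prop :=
  IsMatchingRotaBaxter lam D ∧
    ∀ (R : Type r) [Ring R] [Algebra k R] (P : Ω → R →ₗ[k] R),
      IsMatchingRotaBaxter lam (OperatedData.ofAlgebra P) →
      ∀ f : X → R, ∃! φ : A →ₗ[k] R,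
        IsOperatedHom D (OperatedData.ofAlgebra P) φ ∧ ∀ x, φ (j x) = f x

/-- An `Ω`-operated filtered algebra: an operated algebra with an exhaustive increasing
filtration by submodules, compatible with unit and product, and raised by at most one by
each operator. -/
structure IsOperatedFiltered (D : OperatedData k Ω A) (F : ℕ → Submodule k A) : Prop
    extends IsOperatedAlgebra D where
  mono : Monotone F
  exhaustive : ∀ a, ∃ n, a ∈ F n
  one_mem : D.one ∈ F 0
  mul_mem : ∀ p q a b, a ∈ F p → b ∈ F q → D.mul a b ∈ F (p + q)
  op_mem : ∀ ω n a, a ∈ F n → D.op ω a ∈ F (n + 1)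

/-- Homomorphisms of operated filtered algebras. -/
structure IsOperatedFilteredHom (D : OperatedData k Ω A) (F : ℕ → Submodule k A)
    (E : OperatedData k Ω B) (G : ℕ → Submodule k B) (φ : A →ₗ[k] B) : Prop
    extends IsOperatedHom D E φ where
  map_filtration : ∀ n a, a ∈ F n → φ a ∈ G n

end Predicates

/-- Linear extension to `k M` of a map given on the basis `M`. -/
noncomputable def linExt (k : Type*) {M V : Type*} [CommRing k] [AddCommGroup V] [Module k V]
    (f : M → V) : MonoidAlgebra k M →ₗ[k] V :=
  Finsupp.linearCombination k f ∘ₗ (MonoidAlgebra.coeffLinearEquiv k).toLinearMap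

theorem linExt_single (k : Type*) {M V : Type*} [CommRing k] [AddCommGroup V] [Module k V]
    (f : M → V) (m : M) : linExt k f (MonoidAlgebra.single m 1) = f m := by
  simp [linExt]

/-! ### Decorated planar rooted trees and forests -/

/-- Planar rooted trees with all vertices decorated by `D`: a root with its decoration and
the ordered list of its branches. -/
inductive PTree (D : Type*) : Type _
  | node (d : D) (branches : List (PTree D)) : PTree D

mutual
/-- The number of vertices of a planar rooted tree. -/
def PTree.numVertices {D : Type*} : PTree D → ℕ
  | .node _ ts => PTree.numVerticesList ts + 1
/-- The total number of vertices of a list of planar rooted trees. -/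
def PTree.numVerticesList {D : Type*} : List (PTree D) → ℕ
  | [] => 0
  | t :: ts => PTree.numVertices t + PTree.numVerticesList ts
end

/-- Trees decorated by `X ⊔ Ω` in which elements of `X` decorate leaves only. -/
inductive LeafCondition {X Ω : Type*} : PTree (X ⊕ Ω) → Prop
  | leaf (x : X) : LeafCondition (.node (Sum.inl x) [])
  | node (ω : Ω) (ts : List (PTree (X ⊕ Ω))) (h : ∀ t ∈ ts, LeafCondition t) :
      LeafCondition (.node (Sum.inr ω) ts)

/-- The set `T(X, Ω)`. -/
abbrev XTree (X Ω : Type*) : Type _ := {t : PTree (X ⊕ Ω) // LeafCondition t}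

/-- The monoid `F(X, Ω)` of forests, the free monoid on `T(X, Ω)` under concatenation. -/
abbrev Forest (X Ω : Type*) : Type _ := FreeMonoid (XTree X Ω)

/-- The degree of a forest: its number of vertices. -/
def Forest.deg {X Ω : Type*} (F : Forest X Ω) : ℕ :=
  PTree.numVerticesList (F.toList.map Subtype.val)

/-- The one-vertex tree decorated by `x`. -/
def dot {X : Type*} (Ω : Type*) (x : X) : Forest X Ω :=
  FreeMonoid.of ⟨.node (Sum.inl x) [], .leaf x⟩

/-- The grafting of a forest on a new root decorated by `ω`. -/
def graft {X Ω : Type*} (ω : Ω) (F : Forest X Ω) : Forest X Ω :=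
  FreeMonoid.of ⟨.node (Sum.inr ω) (F.toList.map Subtype.val), .node ω _ (by
    intro t ht
    obtain ⟨s, _, rfl⟩ := List.mem_map.1 ht
    exact s.2)⟩

/-! ### Bracketed words -/

/-- The letters of bracketed words: an element of `X`, or a bracketed word `w` enclosed in a
bracket of index `ω`. -/
inductive Letter (X Ω : Type*) : Type _
  | var (x : X) : Letter X Ω
  | br (ω : Ω) (w : List (Letter X Ω)) : Letter X Ω

/-- The monoid `M(X, Ω)` of bracketed words, that is the free monoid on the disjoint union of
`X` and of one copy `⌊M(X, Ω)⌋_ω` of itself for each `ω`. -/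
abbrev Word (X Ω : Type*) : Type _ := FreeMonoid (Letter X Ω)

/-- The word with the only letter `x`. -/
def varWord {X : Type*} (Ω : Type*) (x : X) : Word X Ω := FreeMonoid.of (.var x)

/-- The word `⌊w⌋_ω`. -/
def bracket {X Ω : Type*} (ω : Ω) (w : Word X Ω) : Word X Ω := FreeMonoid.of (.br ω w.toList)

mutual
/-- The total degree of a letter: number of occurrences of variables and brackets. -/
def Letter.deg {X Ω : Type*} : Letter X Ω → ℕ
  | .var _ => 1
  | .br _ w => Letter.degList w + 1
/-- The total degree of a list of letters. -/
def Letter.degList {X Ω : Type*} : List (Letter X Ω) → ℕ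
  | [] => 0
  | a :: w => Letter.deg a + Letter.degList w
end

theorem Letter.deg_le_degList {X Ω : Type*} {a : Letter X Ω} {w : List (Letter X Ω)}
    (h : a ∈ w) : a.deg ≤ Letter.degList w := by
  induction w with
  | nil => simp at h
  | cons b w ih =>
    rw [Letter.degList]
    rcases List.mem_cons.1 h with rfl | h
    · omega
    · have := ih h
      omega

/-! ### The isomorphism of bracketed words and forests -/

mutual
/-- The tree of a letter. -/
def Letter.toTree {X Ω : Type*} : Letter X Ω → PTree (X ⊕ Ω)
  | .var x => .node (Sum.inl x) []
  | .br ω w => .node (Sum.inr ω) (Letter.toTreeList w)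
/-- The list of trees of a list of letters. -/
def Letter.toTreeList {X Ω : Type*} : List (Letter X Ω) → List (PTree (X ⊕ Ω))
  | [] => []
  | a :: w => Letter.toTree a :: Letter.toTreeList w
end

theorem Letter.toTreeList_eq_map {X Ω : Type*} (w : List (Letter X Ω)) :
    Letter.toTreeList w = w.map Letter.toTree := by
  induction w with
  | nil => rw [Letter.toTreeList]; rfl
  | cons a w ih => rw [Letter.toTreeList, ih]; rfl

mutual
theorem Letter.leafCondition_toTree {X Ω : Type*} :
    ∀ a : Letter X Ω, LeafCondition a.toTree
  | .var x => by rw [Letter.toTree]; exact .leaf x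
  | .br ω w => by rw [Letter.toTree]; exact .node ω _ (Letter.leafCondition_toTreeList w)
theorem Letter.leafCondition_toTreeList {X Ω : Type*} :
    ∀ w : List (Letter X Ω), ∀ t ∈ Letter.toTreeList w, LeafCondition t
  | [], t, ht => by simp [Letter.toTreeList] at ht
  | a :: w, t, ht => by
    rw [Letter.toTreeList, List.mem_cons] at ht
    rcases ht with rfl | ht
    · exact Letter.leafCondition_toTree a
    · exact Letter.leafCondition_toTreeList w t ht
end

mutual
theorem Letter.toTree_inj {X Ω : Type*} :
    ∀ a b : Letter X Ω, a.toTree = b.toTree → a = b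
  | .var x, .var y, h => by simpa [Letter.toTree] using h
  | .var x, .br ω w, h => by simp [Letter.toTree] at h
  | .br ω w, .var x, h => by simp [Letter.toTree] at h
  | .br ω w, .br ω' w', h => by
    simp only [Letter.toTree, PTree.node.injEq, Sum.inr.injEq] at h
    rw [h.1, Letter.toTreeList_inj w w' h.2]
theorem Letter.toTreeList_inj {X Ω : Type*} :
    ∀ w w' : List (Letter X Ω), Letter.toTreeList w = Letter.toTreeList w' → w = w'
  | [], [], _ => rfl
  | [], _ :: _, h => by simp [Letter.toTreeList] at h
  | _ :: _, [], h => by simp [Letter.toTreeList] at h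
  | a :: w, a' :: w', h => by
    simp only [Letter.toTreeList, List.cons.injEq] at h
    rw [Letter.toTree_inj a a' h.1, Letter.toTreeList_inj w w' h.2]
end

theorem Letter.toTree_surj {X Ω : Type*} {t : PTree (X ⊕ Ω)} (ht : LeafCondition t) :
    ∃ a : Letter X Ω, a.toTree = t := by
  induction ht with
  | leaf x => exact ⟨.var x, by rw [Letter.toTree]⟩
  | node ω ts _ ih =>
    have key : ∀ us : List (PTree (X ⊕ Ω)), (∀ t ∈ us, ∃ a : Letter X Ω, a.toTree = t) →
        ∃ w : List (Letter X Ω), Letter.toTreeList w = us := by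
      intro us
      induction us with
      | nil => exact fun _ => ⟨[], by rw [Letter.toTreeList]⟩
      | cons u us ihu =>
        intro h
        obtain ⟨a, rfl⟩ := h u (by simp)
        obtain ⟨w, rfl⟩ := ihu fun t ht => h t (List.mem_cons_of_mem _ ht)
        exact ⟨a :: w, by rw [Letter.toTreeList]⟩
    obtain ⟨w, rfl⟩ := key ts ih
    exact ⟨.br ω w, by rw [Letter.toTree]⟩

/-- The bijection between letters and trees in `T(X, Ω)`. -/
noncomputable def letterEquiv (X Ω : Type*) : Letter X Ω ≃ XTree X Ω :=
  Equiv.ofBijective (fun a => (⟨a.toTree, a.leafCondition_toTree⟩ : XTree X Ω))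
    ⟨fun a b h => Letter.toTree_inj a b (congrArg Subtype.val h),
     fun t => (Letter.toTree_surj t.2).imp fun _ h => Subtype.ext h⟩

/-- The isomorphism `θ` of monoids from bracketed words to forests. It sends `x` to the tree
with the only vertex `x` (`theta_var`) and brackets to graftings (`theta_bracket`). -/
noncomputable def theta (X Ω : Type*) : Word X Ω ≃* Forest X Ω :=
  FreeMonoid.freeMonoidCongr (letterEquiv X Ω)

theorem theta_var {X : Type*} (Ω : Type*) (x : X) : theta X Ω (varWord Ω x) = dot Ω x := by
  simp only [theta, varWord, dot, FreeMonoid.freeMonoidCongr_of]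
  congr 1

theorem theta_bracket {X Ω : Type*} (ω : Ω) (w : Word X Ω) :
    theta X Ω (bracket ω w) = graft ω (theta X Ω w) := by
  simp only [theta, bracket, graft, FreeMonoid.freeMonoidCongr_of]
  congr 1
  apply Subtype.ext
  change Letter.toTree (.br ω w.toList) = _
  rw [Letter.toTree, Letter.toTreeList_eq_map]
  congr 1
  change _ = List.map _ (List.map _ w.toList)
  rw [List.map_map]
  rfl

/-! ### Matching Rota-Baxter words and forests -/

/-- `⌊Z⌋_Ω`: the words `⌊u⌋_ω` with `u ∈ Z` and `ω ∈ Ω`. -/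
def bracketSet {X Ω : Type*} (Z : Set (Word X Ω)) : Set (Word X Ω) :=
  {w | ∃ ω, ∃ u ∈ Z, w = bracket ω u}

/-- The alternating products `Λ(Y, Z)`. -/
def altProd {X Ω : Type*} (Y Z : Set (Word X Ω)) : Set (Word X Ω) :=
  (⋃ r ≥ 1, (Y * bracketSet Z) ^ r) ∪ (⋃ r ≥ 0, (Y * bracketSet Z) ^ r * Y) ∪
    (⋃ r ≥ 1, (bracketSet Z * Y) ^ r) ∪ (⋃ r ≥ 0, (bracketSet Z * Y) ^ r * bracketSet Z) ∪ {1}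

/-- `S(X)`: the nonempty words in the letters `X`. -/
def varSemigroup (X Ω : Type*) : Set (Word X Ω) :=
  ↑(Subsemigroup.closure (Set.range (varWord (X := X) Ω)))

/-- The sets `𝔛_n`. -/
def rbWordsLevel (X Ω : Type*) : ℕ → Set (Word X Ω)
  | 0 => ↑(Submonoid.closure (Set.range (varWord (X := X) Ω)))
  | n + 1 => altProd (varSemigroup X Ω) (rbWordsLevel X Ω n)

/-- The set `𝔛_∞` of matching Rota-Baxter words. -/
def rbWords (X Ω : Type*) : Set (Word X Ω) := ⋃ n, rbWordsLevel X Ω n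

/-- The sets `𝔏_n = θ(𝔛_n)`. -/
def rbForestsLevel (X Ω : Type*) (n : ℕ) : Set (Forest X Ω) :=
  theta X Ω '' rbWordsLevel X Ω n

/-- The set `𝔏_∞` of matching Rota-Baxter forests. -/
def rbForests (X Ω : Type*) : Set (Forest X Ω) := ⋃ n, rbForestsLevel X Ω n

theorem rbForests_eq (X Ω : Type*) : rbForests X Ω = theta X Ω '' rbWords X Ω := by
  simp only [rbForests, rbForestsLevel, rbWords, Set.image_iUnion]

/-! An explicit description of `𝔛_∞`, used to see that it is closed under the product. -/

/-- Whether a letter is a bracket. -/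
def Letter.IsBr {X Ω : Type*} : Letter X Ω → Prop
  | .var _ => False
  | .br _ _ => True

/-- Words without adjacent brackets, at any depth. -/
inductive IsRB {X Ω : Type*} : List (Letter X Ω) → Prop
  | mk (w : List (Letter X Ω)) (chain : w.IsChain fun a b => ¬(a.IsBr ∧ b.IsBr))
      (sub : ∀ ω u, Letter.br ω u ∈ w → IsRB u) : IsRB w

theorem IsRB.append {X Ω : Type*} {u v : List (Letter X Ω)} (hu : IsRB u) (hv : IsRB v)
    (h : ∀ a ∈ u.getLast?, ∀ b ∈ v.head?, ¬(a.IsBr ∧ b.IsBr)) : IsRB (u ++ v) := by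
  obtain ⟨_, cu, su⟩ := hu
  obtain ⟨_, cv, sv⟩ := hv
  refine ⟨_, List.isChain_append.2 ⟨cu, cv, h⟩, fun ω t ht => ?_⟩
  rcases List.mem_append.1 ht with ht | ht
  · exact su ω t ht
  · exact sv ω t ht

theorem IsRB.of_append {X Ω : Type*} {u v : List (Letter X Ω)} (h : IsRB (u ++ v)) :
    IsRB u ∧ IsRB v ∧ ∀ a ∈ u.getLast?, ∀ b ∈ v.head?, ¬(a.IsBr ∧ b.IsBr) := by
  obtain ⟨_, c, s⟩ := h
  obtain ⟨cu, cv, h⟩ := List.isChain_append.1 c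
  exact ⟨⟨_, cu, fun ω t ht => s ω t (List.mem_append_left _ ht)⟩,
    ⟨_, cv, fun ω t ht => s ω t (List.mem_append_right _ ht)⟩, h⟩

theorem IsRB.nil {X Ω : Type*} : IsRB ([] : List (Letter X Ω)) :=
  ⟨_, List.isChain_nil, by simp⟩

theorem IsRB.var {X Ω : Type*} (x : X) : IsRB [(.var x : Letter X Ω)] :=
  ⟨_, List.isChain_singleton _, by simp⟩

theorem isRB_br {X Ω : Type*} {ω : Ω} {u : List (Letter X Ω)} : IsRB [.br ω u] ↔ IsRB u := by
  refine ⟨fun ⟨_, _, s⟩ => s ω u (by simp), fun h => ⟨_, List.isChain_singleton _, ?_⟩⟩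
  intro ω' u' h'
  simp only [List.mem_singleton, Letter.br.injEq] at h'
  rw [h'.2]
  exact h

theorem isRB_of_forall_var {X Ω : Type*} {w : List (Letter X Ω)} (h : ∀ a ∈ w, ¬a.IsBr) :
    IsRB w := by
  refine ⟨_, ?_, fun ω u hu => (h _ hu trivial).elim⟩
  induction w with
  | nil => exact List.isChain_nil
  | cons a w ih =>
    exact List.isChain_append (l₁ := [a]).2 ⟨List.isChain_singleton _,
      ih fun b hb => h b (List.mem_cons_of_mem _ hb),
      fun b hb c _ hbc => h b (by simp at hb; simp [hb]) hbc.1⟩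

theorem varSemigroup_spec {X Ω : Type*} {w : Word X Ω} (h : w ∈ varSemigroup X Ω) :
    w.toList ≠ [] ∧ IsRB w.toList ∧ ∀ a ∈ w.toList, ¬a.IsBr := by
  change w ∈ Subsemigroup.closure (Set.range (varWord (X := X) Ω)) at h
  induction h using Subsemigroup.closure_induction with
  | mem w h =>
    obtain ⟨x, rfl⟩ := h
    exact ⟨by simp [varWord], IsRB.var x, by simp [varWord, Letter.IsBr]⟩
  | mul u v _ _ hu hv =>
    rw [FreeMonoid.toList_mul]
    refine ⟨by simp [hu.1], hu.2.1.append hv.2.1 fun a ha b _ h =>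
      hu.2.2 a (List.mem_of_getLast? ha) h.1, fun a ha => ?_⟩
    rcases List.mem_append.1 ha with ha | ha
    · exact hu.2.2 a ha
    · exact hv.2.2 a ha

theorem isRB_of_mem_altProd {X Ω : Type*} {Z : Set (Word X Ω)}
    (hZ : ∀ w ∈ Z, IsRB w.toList) {w : Word X Ω} (hw : w ∈ altProd (varSemigroup X Ω) Z) :
    IsRB w.toList := by
  have hB : ∀ w ∈ bracketSet Z, IsRB w.toList := by
    rintro _ ⟨ω, u, hu, rfl⟩
    exact isRB_br.2 (hZ u hu)
  have h1 : ∀ r, ∀ w ∈ (varSemigroup X Ω * bracketSet Z) ^ r,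
      IsRB w.toList ∧ ∀ a ∈ w.toList.head?, ¬a.IsBr := by
    intro r
    induction r with
    | zero =>
      intro w hw
      rw [pow_zero, Set.mem_one] at hw
      subst hw
      exact ⟨IsRB.nil, by simp⟩
    | succ r ih =>
      intro w hw
      rw [pow_succ', mul_assoc] at hw
      obtain ⟨y, hy, _, ⟨z, hz, v, hv, rfl⟩, rfl⟩ := hw
      obtain ⟨y1, y2, y3⟩ := varSemigroup_spec hy
      obtain ⟨v1, v2⟩ := ih v hv
      simp only [FreeMonoid.toList_mul]
      refine ⟨y2.append ((hB z hz).append v1 fun a _ b hb h => v2 b hb h.2)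
        fun a ha b _ h => y3 a (List.mem_of_getLast? ha) h.1, fun a ha => y3 a ?_⟩
      rw [List.head?_append_of_ne_nil _ y1] at ha
      exact List.mem_of_head? ha
  have h2 : ∀ r, ∀ w ∈ (bracketSet Z * varSemigroup X Ω) ^ r,
      IsRB w.toList ∧ ∀ a ∈ w.toList.getLast?, ¬a.IsBr := by
    intro r
    induction r with
    | zero =>
      intro w hw
      rw [pow_zero, Set.mem_one] at hw
      subst hw
      exact ⟨IsRB.nil, by simp⟩
    | succ r ih =>
      intro w hw
      rw [pow_succ, ← mul_assoc] at hw
      obtain ⟨_, ⟨v, hv, z, hz, rfl⟩, y, hy, rfl⟩ := hw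
      obtain ⟨y1, y2, y3⟩ := varSemigroup_spec hy
      obtain ⟨v1, v2⟩ := ih v hv
      simp only [FreeMonoid.toList_mul]
      refine ⟨(v1.append (hB z hz) fun a ha b _ h => v2 a ha h.1).append y2
        fun a _ b hb h => y3 b (List.mem_of_head? hb) h.2, fun a ha => y3 a ?_⟩
      rw [List.getLast?_append_of_ne_nil _ y1] at ha
      exact List.mem_of_getLast? ha
  simp only [altProd, Set.mem_union, Set.mem_iUnion, Set.mem_singleton_iff] at hw
  rcases hw with (((⟨r, _, h⟩ | ⟨r, _, h⟩) | ⟨r, _, h⟩) | ⟨r, _, h⟩) | rfl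
  · exact (h1 r w h).1
  · obtain ⟨v, hv, y, hy, rfl⟩ := h
    obtain ⟨y1, y2, y3⟩ := varSemigroup_spec hy
    exact (h1 r v hv).1.append y2 fun a _ b hb h => y3 b (List.mem_of_head? hb) h.2
  · exact (h2 r w h).1
  · obtain ⟨v, hv, z, hz, rfl⟩ := h
    exact (h2 r v hv).1.append (hB z hz) fun a ha b _ h => (h2 r v hv).2 a ha h.1
  · exact IsRB.nil

theorem varWord_mem {X : Type*} (Ω : Type*) (x : X) : varWord Ω x ∈ varSemigroup X Ω :=
  Subsemigroup.subset_closure ⟨x, rfl⟩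

theorem mem_altProd_of {X Ω : Type*} {Z : Set (Word X Ω)} (w : List (Letter X Ω))
    (hw : IsRB w) (hZ : ∀ ω u, Letter.br ω u ∈ w → FreeMonoid.ofList u ∈ Z) :
    FreeMonoid.ofList w ∈ altProd (varSemigroup X Ω) Z := by
  induction w with
  | nil => exact Or.inr rfl
  | cons a w ih =>
    obtain ⟨_, hw', hb⟩ := IsRB.of_append (u := [a]) (v := w) hw
    have hm := ih hw' fun ω u h => hZ ω u (List.mem_cons_of_mem _ h)
    have hsplit : FreeMonoid.ofList (a :: w) = FreeMonoid.of a * FreeMonoid.ofList w := rfl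
    simp only [altProd, Set.mem_union, Set.mem_iUnion, Set.mem_singleton_iff] at hm ⊢
    rw [hsplit]
    cases a with
    | var x =>
      have hx : (FreeMonoid.of (.var x) : Word X Ω) ∈ varSemigroup X Ω := varWord_mem Ω x
      have hsg : ∀ y ∈ varSemigroup X Ω, FreeMonoid.of (.var x) * y ∈ varSemigroup X Ω :=
        fun y hy => (Subsemigroup.closure (Set.range (varWord (X := X) Ω))).mul_mem hx hy
      rcases hm with (((⟨r, hr, h⟩ | ⟨r, _, h⟩) | ⟨r, _, h⟩) | ⟨r, _, h⟩) | h
      · obtain ⟨r, rfl⟩ := Nat.exists_eq_succ_of_ne_zero (Nat.one_le_iff_ne_zero.1 hr)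
        rw [Nat.succ_eq_add_one, pow_succ', mul_assoc] at h
        obtain ⟨y, hy, v, hv, h⟩ := h
        refine Or.inl (Or.inl (Or.inl (Or.inl ⟨r + 1, by omega, ?_⟩)))
        rw [pow_succ', mul_assoc, ← h]
        exact ⟨_, hsg y hy, v, hv, by simp only [mul_assoc]⟩
      · refine Or.inl (Or.inl (Or.inl (Or.inr ⟨r, by omega, ?_⟩)))
        rw [mul_pow_mul] at h ⊢
        obtain ⟨y, hy, v, hv, h⟩ := h
        rw [← h]
        exact ⟨_, hsg y hy, v, hv, by simp only [mul_assoc]⟩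
      · refine Or.inl (Or.inl (Or.inl (Or.inr ⟨r, by omega, ?_⟩)))
        rw [mul_pow_mul]
        exact ⟨_, hx, _, h, rfl⟩
      · refine Or.inl (Or.inl (Or.inl (Or.inl ⟨r + 1, by omega, ?_⟩)))
        rw [mul_pow_mul] at h
        rw [pow_succ', mul_assoc]
        exact ⟨_, hx, _, h, rfl⟩
      · refine Or.inl (Or.inl (Or.inl (Or.inr ⟨0, by omega, ?_⟩)))
        rw [h, pow_zero, one_mul, mul_one]
        exact hx
    | br ω u =>
      have hz : (FreeMonoid.of (.br ω u) : Word X Ω) ∈ bracketSet Z :=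
        ⟨ω, FreeMonoid.ofList u, hZ ω u (by simp), rfl⟩
      have hbad : ∀ v ∈ bracketSet Z, ∀ t, FreeMonoid.ofList w ≠ v * t := by
        rintro _ ⟨ω', u', _, rfl⟩ t ht
        have : w = .br ω' u'.toList :: t.toList := congrArg FreeMonoid.toList ht
        exact hb (.br ω u) (by simp) (.br ω' u'.toList) (by simp [this]) ⟨trivial, trivial⟩
      rcases hm with (((⟨r, hr, h⟩ | ⟨r, _, h⟩) | ⟨r, hr, h⟩) | ⟨r, _, h⟩) | h
      · refine Or.inl (Or.inr ⟨r, by omega, ?_⟩)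
        rw [mul_pow_mul]
        exact ⟨_, hz, _, h, rfl⟩
      · refine Or.inl (Or.inl (Or.inr ⟨r + 1, by omega, ?_⟩))
        rw [pow_succ', mul_assoc]
        rw [mul_pow_mul] at h
        exact ⟨_, hz, _, h, rfl⟩
      · exfalso
        obtain ⟨r, rfl⟩ := Nat.exists_eq_succ_of_ne_zero (Nat.one_le_iff_ne_zero.1 hr)
        rw [Nat.succ_eq_add_one, pow_succ', mul_assoc] at h
        obtain ⟨v, hv, t, _, h⟩ := h
        exact hbad v hv t h.symm
      · exfalso
        rw [mul_pow_mul] at h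
        obtain ⟨v, hv, t, _, h⟩ := h
        exact hbad v hv t h.symm
      · refine Or.inl (Or.inr ⟨0, by omega, ?_⟩)
        rw [h, pow_zero, one_mul, mul_one]
        exact hz

theorem mem_rbWords_iff {X Ω : Type*} {w : Word X Ω} : w ∈ rbWords X Ω ↔ IsRB w.toList := by
  constructor
  · intro h0
    obtain ⟨n, h⟩ := Set.mem_iUnion.1 h0
    clear h0
    induction n generalizing w with
    | zero =>
      refine isRB_of_forall_var ?_
      change w ∈ Submonoid.closure (Set.range (varWord (X := X) Ω)) at h
      induction h using Submonoid.closure_induction with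
      | mem w h =>
        obtain ⟨x, rfl⟩ := h
        simp [varWord, Letter.IsBr]
      | one => simp
      | mul u v _ _ hu hv =>
        intro a ha
        rw [FreeMonoid.toList_mul] at ha
        rcases List.mem_append.1 ha with ha | ha
        · exact hu a ha
        · exact hv a ha
    | succ n ih =>
      exact isRB_of_mem_altProd (fun w hw => ih hw) h
  · intro h
    have key : ∀ n, ∀ w : List (Letter X Ω), IsRB w → Letter.degList w ≤ n →
        FreeMonoid.ofList w ∈ rbWordsLevel X Ω n := by
      intro n
      induction n with
      | zero =>
        intro w hw hd
        cases w with
        | nil => exact (Submonoid.closure (Set.range (varWord (X := X) Ω))).one_mem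
        | cons a w =>
          exfalso
          have : 1 ≤ a.deg := by cases a <;> simp [Letter.deg]
          rw [Letter.degList] at hd
          omega
      | succ n ih =>
        intro w hw hd
        refine mem_altProd_of (Z := rbWordsLevel X Ω n) w hw fun ω u hu => ih u ?_ ?_
        · obtain ⟨_, _, s⟩ := hw
          exact s ω u hu
        · have := Letter.deg_le_degList hu
          rw [Letter.deg] at this
          omega
    exact Set.mem_iUnion.2 ⟨_, key _ w.toList h le_rfl⟩

/-! ### The product on matching Rota-Baxter words -/

/-- The linear extension of the bracket operator `P_ω` to `k M(X, Ω)`. -/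
noncomputable def bracketLin (k : Type*) {X Ω : Type*} [CommRing k] (ω : Ω) :
    MonoidAlgebra k (Word X Ω) →ₗ[k] MonoidAlgebra k (Word X Ω) :=
  MonoidAlgebra.mapDomainLinearMap k k (bracket ω)

mutual
/-- The product of two letters. -/
noncomputable def diamondLetter {k X Ω : Type*} [CommRing k] (lam : Ω → k) :
    Letter X Ω → Letter X Ω → MonoidAlgebra k (Word X Ω)
  | .br α s, .br β t =>
      bracketLin k α (diamondWord lam s [.br β t]) + bracketLin k β (diamondWord lam [.br α s] t)
        + lam β • bracketLin k α (diamondWord lam s t)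
  | .br α s, .var y => MonoidAlgebra.single (FreeMonoid.of (.br α s) * FreeMonoid.of (.var y)) 1
  | .var x, b => MonoidAlgebra.single (FreeMonoid.of (.var x) * FreeMonoid.of b) 1
termination_by a b => (a.deg + b.deg, 0)
decreasing_by all_goals simp [Letter.deg, Letter.degList, Prod.lex_def]; try omega
/-- The product `w ⋄ w'` of words: the last letter of `w` is multiplied with the first letter
of `w'`, and the rest is concatenated. The same recursion makes sense for all words, and is
used for matching Rota-Baxter words only. -/
noncomputable def diamondWord {k X Ω : Type*} [CommRing k] (lam : Ω → k)
    (w w' : List (Letter X Ω)) : MonoidAlgebra k (Word X Ω) :=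
  if h : w = [] ∨ w' = [] then
    MonoidAlgebra.single (FreeMonoid.ofList w * FreeMonoid.ofList w') 1
  else
    MonoidAlgebra.single (FreeMonoid.ofList w.dropLast) 1 *
      diamondLetter lam (w.getLast fun e => h (Or.inl e)) (w'.head fun e => h (Or.inr e)) *
      MonoidAlgebra.single (FreeMonoid.ofList w'.tail) 1
termination_by (Letter.degList w + Letter.degList w', 1)
decreasing_by
  have h1 := Letter.deg_le_degList (List.getLast_mem fun e => h (Or.inl e))
  have h2 := Letter.deg_le_degList (List.head_mem fun e => h (Or.inr e))
  rw [Prod.lex_def]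
  simp only
  omega
end

theorem bracketLin_mem {k X Ω : Type*} [CommRing k] (ω : Ω) {a : MonoidAlgebra k (Word X Ω)}
    (ha : a ∈ MonoidAlgebra.supported k k (rbWords X Ω)) :
    bracketLin k ω a ∈
      MonoidAlgebra.supported k k {v | ∃ α, ∃ u ∈ rbWords X Ω, v = bracket α u} := by
  rw [MonoidAlgebra.supported_eq_span_single] at ha ⊢
  induction ha using Submodule.span_induction with
  | mem a h =>
    obtain ⟨w, hw, rfl⟩ := h
    rw [bracketLin, MonoidAlgebra.mapDomainLinearMap_single]
    exact Submodule.subset_span ⟨_, ⟨ω, w, hw, rfl⟩, rfl⟩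
  | zero => rw [map_zero]; exact Submodule.zero_mem _
  | add a b _ _ ha hb => rw [map_add]; exact Submodule.add_mem _ ha hb
  | smul c a _ ha => rw [map_smul]; exact Submodule.smul_mem _ c ha

theorem diamondWord_mem {k X Ω : Type*} [CommRing k] (lam : Ω → k) (n : ℕ) :
    ∀ w w' : List (Letter X Ω), Letter.degList w + Letter.degList w' ≤ n → IsRB w → IsRB w' →
      diamondWord lam w w' ∈ MonoidAlgebra.supported k k (rbWords X Ω) := by
  have hsingle : ∀ w : List (Letter X Ω), IsRB w →
      MonoidAlgebra.single (FreeMonoid.ofList w) (1 : k) ∈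
        MonoidAlgebra.supported k k (rbWords X Ω) := by
    intro w hw
    rw [MonoidAlgebra.supported_eq_span_single]
    exact Submodule.subset_span ⟨_, mem_rbWords_iff.2 hw, rfl⟩
  induction n with
  | zero =>
    intro w w' hd hw hw'
    rw [diamondWord]
    have hpos : ∀ v : List (Letter X Ω), Letter.degList v = 0 → v = [] := by
      intro v hv
      cases v with
      | nil => rfl
      | cons a v =>
        have : 1 ≤ a.deg := by cases a <;> simp [Letter.deg]
        rw [Letter.degList] at hv
        omega
    obtain rfl := hpos w (by omega)
    rw [dif_pos (Or.inl rfl)]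
    exact hsingle _ hw'
  | succ n ih =>
    intro w w' hd hw hw'
    rw [diamondWord]
    split_ifs with h
    · rcases h with rfl | rfl
      · exact hsingle _ hw'
      · rw [show FreeMonoid.ofList w * FreeMonoid.ofList [] = FreeMonoid.ofList w from mul_one _]
        exact hsingle _ hw
    · rw [not_or] at h
      obtain ⟨p, a, rfl⟩ : ∃ p a, w = p ++ [a] :=
        ⟨_, _, (List.dropLast_append_getLast h.1).symm⟩
      obtain ⟨b, q, rfl⟩ : ∃ b q, w' = b :: q := ⟨_, _, (List.cons_head_tail h.2).symm⟩
      obtain ⟨hp, ha, hpa⟩ := IsRB.of_append hw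
      obtain ⟨hb, hq, hbq⟩ := IsRB.of_append (u := [b]) (v := q) hw'
      have hda := Letter.deg_le_degList (a := a) (w := p ++ [a]) (by simp)
      have hdb : b.deg ≤ Letter.degList (b :: q) := Letter.deg_le_degList (by simp)
      simp only [List.dropLast_concat, List.getLast_append_singleton, List.head_cons,
        List.tail_cons]
      have hconcat : ¬(a.IsBr ∧ b.IsBr) →
          MonoidAlgebra.single (FreeMonoid.ofList p) (1 : k) *
            MonoidAlgebra.single (FreeMonoid.of a * FreeMonoid.of b) 1 *
            MonoidAlgebra.single (FreeMonoid.ofList q) 1 ∈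
              MonoidAlgebra.supported k k (rbWords X Ω) := by
        intro hab
        rw [MonoidAlgebra.single_mul_single, MonoidAlgebra.single_mul_single, one_mul, one_mul]
        have := hsingle ((p ++ [a]) ++ (b :: q)) (hw.append hw' (by simpa using hab))
        convert this using 2
        simp [FreeMonoid.ofList_append, FreeMonoid.ofList_cons, mul_assoc]
      cases a with
      | var x => rw [diamondLetter]; exact hconcat fun h => h.1
      | br α s =>
        cases b with
        | var y => rw [diamondLetter]; exact hconcat fun h => h.2
        | br β t =>
          rw [diamondLetter]
          have hs := isRB_br.1 ha
          have ht := isRB_br.1 hb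
          rw [Letter.deg] at hda hdb
          have h1 := bracketLin_mem α (ih s [.br β t]
            (by simp only [Letter.degList, Letter.deg]; omega) hs hb)
          have h2 := bracketLin_mem β (ih [.br α s] t
            (by simp only [Letter.degList, Letter.deg]; omega) ha ht)
          have h3 := bracketLin_mem α (ih s t (by omega) hs ht)
          have h4 := Submodule.add_mem _ (Submodule.add_mem _ h1 h2)
            (Submodule.smul_mem _ (lam β) h3)
          generalize bracketLin k α (diamondWord lam s [.br β t]) +
            bracketLin k β (diamondWord lam [.br α s] t) +
            lam β • bracketLin k α (diamondWord lam s t) = z at h4 ⊢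
          rw [MonoidAlgebra.supported_eq_span_single] at h4
          induction h4 using Submodule.span_induction with
          | mem z h =>
            obtain ⟨_, ⟨γ, u, hu, rfl⟩, rfl⟩ := h
            have hu' : IsRB [Letter.br γ u.toList] := isRB_br.2 (mem_rbWords_iff.1 hu)
            rw [MonoidAlgebra.single_mul_single, MonoidAlgebra.single_mul_single, one_mul,
              one_mul]
            refine hsingle (p ++ [Letter.br γ u.toList] ++ q) ((hp.append hu' ?_).append hq ?_)
            · intro c hc d _ hcd
              exact hpa c hc (.br α s) (by simp) ⟨hcd.1, trivial⟩
            · intro c _ d hd hcd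
              exact hbq (.br β t) (by simp) d hd ⟨trivial, hcd.2⟩
          | zero => simp
          | add y z _ _ hy hz => rw [mul_add, add_mul]; exact Submodule.add_mem _ hy hz
          | smul c z _ hz =>
            rw [mul_smul_comm, smul_mul_assoc]
            exact Submodule.smul_mem _ c hz

/-- The submodule `k 𝔛_∞`. -/
noncomputable abbrev rbWordModule (k X Ω : Type*) [CommRing k] :
    Submodule k (MonoidAlgebra k (Word X Ω)) :=
  MonoidAlgebra.supported k k (rbWords X Ω)

/-- The submodule `k 𝔏_∞`. -/
noncomputable abbrev rbForestModule (k X Ω : Type*) [CommRing k] :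
    Submodule k (MonoidAlgebra k (Forest X Ω)) :=
  MonoidAlgebra.supported k k (rbForests X Ω)

/-- Bilinear extension of `diamondWord`. -/
noncomputable def diamondLin {k X Ω : Type*} [CommRing k] (lam : Ω → k) :
    MonoidAlgebra k (Word X Ω) →ₗ[k] MonoidAlgebra k (Word X Ω) →ₗ[k]
      MonoidAlgebra k (Word X Ω) :=
  linExt k fun w => linExt k fun w' => diamondWord lam w.toList w'.toList

theorem diamondLin_mem {k X Ω : Type*} [CommRing k] (lam : Ω → k)
    {a b : MonoidAlgebra k (Word X Ω)} (ha : a ∈ rbWordModule k X Ω)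
    (hb : b ∈ rbWordModule k X Ω) : diamondLin lam a b ∈ rbWordModule k X Ω := by
  rw [rbWordModule, MonoidAlgebra.supported_eq_span_single] at ha hb
  induction ha using Submodule.span_induction with
  | mem a h =>
    obtain ⟨w, hw, rfl⟩ := h
    induction hb using Submodule.span_induction with
    | mem b h =>
      obtain ⟨w', hw', rfl⟩ := h
      simp only [diamondLin, linExt_single]
      exact diamondWord_mem lam _ _ _ le_rfl (mem_rbWords_iff.1 hw) (mem_rbWords_iff.1 hw')
    | zero => rw [map_zero]; exact Submodule.zero_mem _
    | add a b _ _ ha hb => rw [map_add]; exact Submodule.add_mem _ ha hb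
    | smul c a _ ha => rw [map_smul]; exact Submodule.smul_mem _ c ha
  | zero => rw [map_zero]; exact Submodule.zero_mem _
  | add a b _ _ ha hb => rw [map_add]; exact Submodule.add_mem _ ha hb
  | smul c a _ ha => rw [map_smul]; exact Submodule.smul_mem _ c ha

/-- The product `⋄` on `k 𝔛_∞`. -/
noncomputable def diamondW {k X Ω : Type*} [CommRing k] (lam : Ω → k) :
    rbWordModule k X Ω →ₗ[k] rbWordModule k X Ω →ₗ[k] rbWordModule k X Ω :=
  LinearMap.mk₂ k (fun a b => ⟨diamondLin lam a.1 b.1, diamondLin_mem lam a.2 b.2⟩)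
    (fun a b c => Subtype.ext (by simp)) (fun c a b => Subtype.ext (by simp))
    (fun a b c => Subtype.ext (by simp)) (fun c a b => Subtype.ext (by simp))

/-! ### Transport to forests -/

/-- The linear extension `θ : k M(X, Ω) → k F(X, Ω)`. -/
noncomputable def thetaLin (k X Ω : Type*) [CommRing k] :
    MonoidAlgebra k (Word X Ω) ≃ₗ[k] MonoidAlgebra k (Forest X Ω) :=
  MonoidAlgebra.mapDomainLinearEquiv k k (theta X Ω).toEquiv

theorem thetaLin_map (k X Ω : Type*) [CommRing k] :
    (rbWordModule k X Ω).map (thetaLin k X Ω : _ →ₗ[k] MonoidAlgebra k (Forest X Ω)) =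
      rbForestModule k X Ω := by
  rw [rbWordModule, rbForestModule, MonoidAlgebra.supported_eq_span_single,
    MonoidAlgebra.supported_eq_span_single, Submodule.map_span, rbForests_eq, Set.image_image,
    Set.image_image]
  congr 1
  refine Set.image_congr fun w _ => ?_
  simp [thetaLin]

/-- The restriction `θ : k 𝔛_∞ → k 𝔏_∞`. -/
noncomputable def thetaRB (k X Ω : Type*) [CommRing k] :
    rbWordModule k X Ω ≃ₗ[k] rbForestModule k X Ω :=
  LinearEquiv.ofSubmodules (thetaLin k X Ω) _ _ (thetaLin_map k X Ω)

/-- The product `F ⋄ F' = θ(θ⁻¹(F) ⋄ θ⁻¹(F'))` on `k 𝔏_∞`. -/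
noncomputable def diamondF {k X Ω : Type*} [CommRing k] (lam : Ω → k) :
    rbForestModule k X Ω →ₗ[k] rbForestModule k X Ω →ₗ[k] rbForestModule k X Ω :=
  LinearMap.mk₂ k
    (fun a b => thetaRB k X Ω
      (diamondW lam ((thetaRB k X Ω).symm a) ((thetaRB k X Ω).symm b)))
    (fun a b c => by simp) (fun c a b => by simp) (fun a b c => by simp) (fun c a b => by simp)

/-- The grafting operator `B⁺_ω` on `k F(X, Ω)`. -/
noncomputable def graftLin (k : Type*) {X Ω : Type*} [CommRing k] (ω : Ω) :
    MonoidAlgebra k (Forest X Ω) →ₗ[k] MonoidAlgebra k (Forest X Ω) :=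
  MonoidAlgebra.mapDomainLinearMap k k (graft ω)

theorem graft_mem {X Ω : Type*} (ω : Ω) {F : Forest X Ω} (hF : F ∈ rbForests X Ω) :
    graft ω F ∈ rbForests X Ω := by
  rw [rbForests_eq] at hF ⊢
  obtain ⟨w, hw, rfl⟩ := hF
  exact ⟨bracket ω w, mem_rbWords_iff.2 (isRB_br.2 (mem_rbWords_iff.1 hw)), theta_bracket ω w⟩

theorem graftLin_mem {k X Ω : Type*} [CommRing k] (ω : Ω) :
    ∀ a ∈ rbForestModule k X Ω, graftLin k ω a ∈ rbForestModule k X Ω := by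
  intro a ha
  rw [rbForestModule, MonoidAlgebra.supported_eq_span_single] at ha ⊢
  induction ha using Submodule.span_induction with
  | mem a h =>
    obtain ⟨w, hw, rfl⟩ := h
    rw [graftLin, MonoidAlgebra.mapDomainLinearMap_single]
    exact Submodule.subset_span ⟨_, graft_mem ω hw, rfl⟩
  | zero => rw [map_zero]; exact Submodule.zero_mem _
  | add a b _ _ ha hb => rw [map_add]; exact Submodule.add_mem _ ha hb
  | smul c a _ ha => rw [map_smul]; exact Submodule.smul_mem _ c ha

theorem single_mem_rbForestModule (k : Type*) {X Ω : Type*} [CommRing k] {F : Forest X Ω}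
    (h : F ∈ rbForests X Ω) : MonoidAlgebra.single F (1 : k) ∈ rbForestModule k X Ω := by
  rw [rbForestModule, MonoidAlgebra.supported_eq_span_single]
  exact Submodule.subset_span ⟨F, h, rfl⟩

theorem one_mem_rbForests (X Ω : Type*) : (1 : Forest X Ω) ∈ rbForests X Ω := by
  rw [rbForests_eq]
  exact ⟨1, mem_rbWords_iff.2 IsRB.nil, map_one _⟩

theorem dot_mem_rbForests {X : Type*} (Ω : Type*) (x : X) : dot Ω x ∈ rbForests X Ω := by
  rw [rbForests_eq]
  exact ⟨varWord Ω x, mem_rbWords_iff.2 (IsRB.var x), theta_var Ω x⟩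

/-- The module `k 𝔏_∞` with the product `⋄`, the empty forest and the grafting operators. -/
noncomputable def rbForestAlgebra {k Ω : Type*} (X : Type*) [CommRing k] (lam : Ω → k) :
    OperatedData k Ω (rbForestModule k X Ω) where
  mul := diamondF lam
  one := ⟨MonoidAlgebra.single 1 1, single_mem_rbForestModule k (one_mem_rbForests X Ω)⟩
  op ω := (graftLin k ω).restrict (graftLin_mem ω)

/-- The map `x ↦ •_x` to `k 𝔏_∞`. -/
noncomputable def dotRB (k Ω : Type*) {X : Type*} [CommRing k] (x : X) :
    rbForestModule k X Ω :=
  ⟨MonoidAlgebra.single (dot Ω x) 1, single_mem_rbForestModule k (dot_mem_rbForests Ω x)⟩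

/-- The algebra `k F(X, Ω)` with concatenation, and the grafting operators. -/
noncomputable def forestAlgebra (k X Ω : Type*) [CommRing k] :
    OperatedData k Ω (MonoidAlgebra k (Forest X Ω)) :=
  OperatedData.ofAlgebra (graftLin k)

/-- The degree filtration of `k F(X, Ω)`. -/
noncomputable def forestFiltration (k X Ω : Type*) [CommRing k] (n : ℕ) :
    Submodule k (MonoidAlgebra k (Forest X Ω)) :=
  MonoidAlgebra.supported k k {F | F.deg ≤ n}

/-- The filtration of `k 𝔏_∞` by the submodules `k 𝔏_(n)`, where `𝔏_(n)` consists of the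
forests in `𝔏_∞` of degree at most `n`. -/
noncomputable def rbForestFiltration (k X Ω : Type*) [CommRing k] (n : ℕ) :
    Submodule k (rbForestModule k X Ω) :=
  (MonoidAlgebra.supported k k {F | F ∈ rbForests X Ω ∧ F.deg ≤ n}).comap
    (rbForestModule k X Ω).subtype

/-! ### The projection -/

/-- The set `S` of matching Rota-Baxter relations in `k M(X, Ω)`. -/
def rbRelations {k Ω : Type*} (X : Type*) [CommRing k] (lam : Ω → k) :
    Set (MonoidAlgebra k (Word X Ω)) :=
  {s | ∃ (α β : Ω) (x y : Word X Ω),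
    s = MonoidAlgebra.single (bracket α x * bracket β y) 1
      - MonoidAlgebra.single (bracket α (x * bracket β y)) 1
      - MonoidAlgebra.single (bracket β (bracket α x * y)) 1
      - lam β • MonoidAlgebra.single (bracket α (x * y)) 1}

/-- The operated ideal `Id(S)` of `k M(X, Ω)` generated by the matching Rota-Baxter relations:
the smallest two-sided ideal that contains them and is stable under the operators. -/
noncomputable def rbIdeal {k Ω : Type*} (X : Type*) [CommRing k] (lam : Ω → k) :
    Submodule k (MonoidAlgebra k (Word X Ω)) :=
  sInf {I | rbRelations X lam ⊆ I ∧ (∀ a b, a ∈ I → b * a ∈ I ∧ a * b ∈ I) ∧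
    ∀ ω, ∀ a ∈ I, bracketLin k ω a ∈ I}

/-- The projection `φ : k M(X, Ω) = Id(S) ⊕ k 𝔛_∞ → k 𝔛_∞`. -/
noncomputable def phi {k X Ω : Type*} [CommRing k] (lam : Ω → k)
    (h : IsCompl (rbWordModule k X Ω) (rbIdeal X lam)) :
    MonoidAlgebra k (Word X Ω) →ₗ[k] rbWordModule k X Ω :=
  Submodule.projectionOnto _ _ h

/-- The projection `ψ = θ φ θ⁻¹ : k F(X, Ω) → k 𝔏_∞`. -/
noncomputable def psi {k X Ω : Type*} [CommRing k] (lam : Ω → k)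
    (h : IsCompl (rbWordModule k X Ω) (rbIdeal X lam)) :
    MonoidAlgebra k (Forest X Ω) →ₗ[k] rbForestModule k X Ω :=
  (thetaRB k X Ω).toLinearMap ∘ₗ phi lam h ∘ₗ (thetaLin k X Ω).symm.toLinearMap

end MatchingRB

namespace MatchingRB

/-! ### Linear maps on monoid algebras -/

section Linear

variable {k M V : Type*} [CommRing k] [AddCommGroup V] [Module k V]

-- The recursion defining `⋄` makes sense for all bracketed words, so the argument takes place on
-- the whole of k M(X, Ω), which carries two operated structures with the same brackets:
-- concatenation (`wordAlgebra`) and `⋄` (`diamondAlgebra`).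
--
-- Concatenation gives the free operated algebra on X: values of the variables extend to a unique
-- homomorphism (`isOperatedHom_eval`, `eq_eval`). The product `⋄` gives a matching Rota-Baxter
-- algebra. The relation is the recursion itself, so the real content is associativity
-- (`diamondLin_single_assoc`). Only the letters at the junctions interact, which reduces it to
-- three letters; for three brackets both sides are expanded and compared by induction on the degree
-- (`diamondLin_letter_assoc`).
--
-- Freeness now yields a homomorphism `normalForm` from concatenation to `⋄` fixing the variables.
-- It fixes every matching Rota-Baxter word, takes values in k 𝔛_∞, moves each element only by an
-- element of Id(S), and kills Id(S) because its target is Rota-Baxter. Hence Id(S) is a complement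
-- of k 𝔛_∞ and `normalForm` is the projection φ, which is therefore a homomorphism.
--
-- For the universal property, evaluation in a matching Rota-Baxter algebra kills Id(S), and a ⋄ b -
-- ab lies in Id(S) (`diamondWord_sub_mem_rbIdeal`), so evaluation is also multiplicative for `⋄`;
-- its restriction along θ⁻¹ is the required map. Uniqueness holds because φ maps the free operated
-- algebra onto k 𝔏_∞. The filtrations are respected because no term of w ⋄ w' has more variables
-- and brackets than w and w' together.

theorem linearMap_ext_single {f g : MonoidAlgebra k M →ₗ[k] V}
    (h : ∀ m, f (MonoidAlgebra.single m 1) = g (MonoidAlgebra.single m 1)) : f = g :=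
  MonoidAlgebra.lhom_ext' fun m => LinearMap.ext_ring (h m)

theorem map_mem_of_mem_supported {S : Set M} {N : Submodule k V} (f : MonoidAlgebra k M →ₗ[k] V)
    (h : ∀ m ∈ S, f (MonoidAlgebra.single m 1) ∈ N) {a : MonoidAlgebra k M}
    (ha : a ∈ MonoidAlgebra.supported k k S) : f a ∈ N := by
  rw [MonoidAlgebra.supported_eq_span_single] at ha
  have : Submodule.span k ((fun m => MonoidAlgebra.single m (1 : k)) '' S) ≤ N.comap f := by
    rw [Submodule.span_le]
    rintro _ ⟨m, hm, rfl⟩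
    exact h m hm
  exact this ha

theorem map₂_mem_of_mem_supported {M' : Type*} {S : Set M} {T : Set M'} {N : Submodule k V}
    (f : MonoidAlgebra k M →ₗ[k] MonoidAlgebra k M' →ₗ[k] V)
    (h : ∀ m ∈ S, ∀ m' ∈ T, f (MonoidAlgebra.single m 1) (MonoidAlgebra.single m' 1) ∈ N)
    {a : MonoidAlgebra k M} (ha : a ∈ MonoidAlgebra.supported k k S)
    {b : MonoidAlgebra k M'} (hb : b ∈ MonoidAlgebra.supported k k T) : f a b ∈ N :=
  map_mem_of_mem_supported (f.flip b)
    (fun m hm => map_mem_of_mem_supported (f (MonoidAlgebra.single m 1)) (h m hm) hb) ha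

theorem map_mem_of_forall_single {N : Submodule k V} (f : MonoidAlgebra k M →ₗ[k] V)
    (h : ∀ m, f (MonoidAlgebra.single m 1) ∈ N) (a : MonoidAlgebra k M) : f a ∈ N :=
  map_mem_of_mem_supported (S := Set.univ) f (fun m _ => h m) (fun _ _ => trivial)

theorem single_mem_supported {S : Set M} {m : M} (h : m ∈ S) :
    MonoidAlgebra.single m (1 : k) ∈ MonoidAlgebra.supported k k S := by
  rw [MonoidAlgebra.supported_eq_span_single]
  exact Submodule.subset_span ⟨m, h, rfl⟩

theorem map_eq_of_mem_supported {S : Set M} {f g : MonoidAlgebra k M →ₗ[k] V}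
    (h : ∀ m ∈ S, f (MonoidAlgebra.single m 1) = g (MonoidAlgebra.single m 1))
    {a : MonoidAlgebra k M} (ha : a ∈ MonoidAlgebra.supported k k S) : f a = g a := by
  have := map_mem_of_mem_supported (N := ⊥) (f - g) (fun m hm => by simp [h m hm]) ha
  simpa [sub_eq_zero] using this

end Linear

/-! ### Associativity of the product `⋄` -/

section Diamond

variable {k X Ω : Type*} [CommRing k] (lam : Ω → k)

-- The product on basis words and on letters.

theorem bracketLin_single (ω : Ω) (w : Word X Ω) :
    bracketLin k ω (MonoidAlgebra.single w 1) = MonoidAlgebra.single (bracket ω w) 1 := by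
  rw [bracketLin, MonoidAlgebra.mapDomainLinearMap_single]

theorem diamondLin_single (w w' : Word X Ω) :
    diamondLin lam (MonoidAlgebra.single w 1) (MonoidAlgebra.single w' 1) =
      diamondWord lam w.toList w'.toList := by
  simp only [diamondLin, linExt_single]

theorem diamondWord_nil_left (w : List (Letter X Ω)) :
    diamondWord lam [] w = MonoidAlgebra.single (FreeMonoid.ofList w) (1 : k) := by
  rw [diamondWord, dif_pos (Or.inl rfl)]
  rfl

theorem diamondWord_nil_right (w : List (Letter X Ω)) :
    diamondWord lam w [] = MonoidAlgebra.single (FreeMonoid.ofList w) (1 : k) := by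
  rw [diamondWord, dif_pos (Or.inr rfl), FreeMonoid.ofList_nil, mul_one]

theorem diamondWord_concat_cons (p q : List (Letter X Ω)) (a b : Letter X Ω) :
    diamondWord lam (p ++ [a]) (b :: q) = MonoidAlgebra.single (FreeMonoid.ofList p) (1 : k) *
      diamondLetter lam a b * MonoidAlgebra.single (FreeMonoid.ofList q) 1 := by
  rw [diamondWord, dif_neg (by simp)]
  simp only [List.dropLast_concat, List.getLast_append_singleton, List.head_cons, List.tail_cons]

theorem diamondLin_one_left (a : MonoidAlgebra k (Word X Ω)) :
    diamondLin lam (MonoidAlgebra.single 1 1) a = a := by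
  suffices diamondLin lam (MonoidAlgebra.single 1 1) = LinearMap.id from
    LinearMap.congr_fun this a
  refine linearMap_ext_single fun w => ?_
  rw [diamondLin_single]
  exact diamondWord_nil_left lam _

theorem diamondLin_one_right (a : MonoidAlgebra k (Word X Ω)) :
    diamondLin lam a (MonoidAlgebra.single 1 1) = a := by
  suffices (diamondLin lam).flip (MonoidAlgebra.single 1 1) = LinearMap.id from
    LinearMap.congr_fun this a
  refine linearMap_ext_single fun w => ?_
  rw [LinearMap.flip_apply, diamondLin_single]
  exact diamondWord_nil_right lam _

theorem diamondLin_single_concat (p q : Word X Ω) (a b : Letter X Ω) :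
    diamondLin lam (MonoidAlgebra.single (p * FreeMonoid.of a) 1)
        (MonoidAlgebra.single (FreeMonoid.of b * q) 1) =
      MonoidAlgebra.single p 1 * diamondLetter lam a b * MonoidAlgebra.single q 1 := by
  rw [diamondLin_single]
  exact diamondWord_concat_cons lam p.toList q.toList a b

theorem diamondLin_single_of (a b : Letter X Ω) :
    diamondLin lam (MonoidAlgebra.single (FreeMonoid.of a) 1)
        (MonoidAlgebra.single (FreeMonoid.of b) 1) = diamondLetter lam a b := by
  have := diamondLin_single_concat lam 1 1 a b
  rwa [one_mul, mul_one, ← MonoidAlgebra.one_def, one_mul, mul_one] at this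

theorem word_eq_concat {w : Word X Ω} (h : w ≠ 1) :
    ∃ (p : Word X Ω) (a : Letter X Ω), w = p * FreeMonoid.of a :=
  ⟨FreeMonoid.ofList (w.toList.dropLast), w.toList.getLast h,
    (List.dropLast_append_getLast h).symm⟩

theorem word_eq_cons {w : Word X Ω} (h : w ≠ 1) :
    ∃ (a : Letter X Ω) (q : Word X Ω), w = FreeMonoid.of a * q :=
  ⟨w.toList.head h, FreeMonoid.ofList w.toList.tail, (List.cons_head_tail h).symm⟩

theorem single_of_mul (a : Letter X Ω) (u : Word X Ω) :
    MonoidAlgebra.single (FreeMonoid.of a * u) (1 : k) =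
      MonoidAlgebra.single (FreeMonoid.of a) 1 * MonoidAlgebra.single u 1 := by
  rw [MonoidAlgebra.single_mul_single, one_mul]

theorem diamondLetter_of_not_isBr {a b : Letter X Ω} (h : ¬(a.IsBr ∧ b.IsBr)) :
    diamondLetter lam a b = MonoidAlgebra.single (FreeMonoid.of a * FreeMonoid.of b) (1 : k) := by
  cases a with
  | var x => rw [diamondLetter]
  | br α s =>
    cases b with
    | var y => rw [diamondLetter]
    | br β t => exact (h ⟨trivial, trivial⟩).elim

theorem diamondLetter_var_left (x : X) (b : Letter X Ω) : diamondLetter lam (.var x) b =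
    MonoidAlgebra.single (FreeMonoid.of (.var x) * FreeMonoid.of b) (1 : k) :=
  diamondLetter_of_not_isBr lam fun h => h.1

theorem diamondLetter_var_right (a : Letter X Ω) (y : X) : diamondLetter lam a (.var y) =
    MonoidAlgebra.single (FreeMonoid.of a * FreeMonoid.of (.var y)) (1 : k) :=
  diamondLetter_of_not_isBr lam fun h => h.2

/-- The linear span of the nonempty words. -/
noncomputable abbrev nonemptySpan (k X Ω : Type*) [CommRing k] :
    Submodule k (MonoidAlgebra k (Word X Ω)) :=
  MonoidAlgebra.supported k k {w | w ≠ 1}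

-- Outer factors pass through the product.

theorem bracketLin_mem_nonemptySpan (ω : Ω) (a : MonoidAlgebra k (Word X Ω)) :
    bracketLin k ω a ∈ nonemptySpan k X Ω :=
  map_mem_of_forall_single _ (fun w => by
    rw [bracketLin_single]
    exact single_mem_supported (by simp [bracket])) a

/-- Needed so that a further factor on either side of a product of two letters can again be pulled
out. -/
theorem diamondLetter_mem_nonemptySpan (a b : Letter X Ω) :
    diamondLetter lam a b ∈ nonemptySpan k X Ω := by
  by_cases h : a.IsBr ∧ b.IsBr
  · cases a with
    | var x => exact h.1.elim
    | br α s =>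
      cases b with
      | var y => exact h.2.elim
      | br β t =>
        rw [diamondLetter]
        exact add_mem (add_mem (bracketLin_mem_nonemptySpan _ _)
          (bracketLin_mem_nonemptySpan _ _))
          (Submodule.smul_mem _ _ (bracketLin_mem_nonemptySpan _ _))
  · rw [diamondLetter_of_not_isBr lam h]
    exact single_mem_supported (by simp)

/-- The product with `b` touches only the last letter of its left factor, and a nonempty `a` shields
`p` from it. For `a = 1` the identity fails in general, since `p` may end in a bracket. -/
theorem diamondLin_single_mul (p : Word X Ω) {a : MonoidAlgebra k (Word X Ω)}
    (ha : a ∈ nonemptySpan k X Ω) (b : MonoidAlgebra k (Word X Ω)) :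
    diamondLin lam (MonoidAlgebra.single p 1 * a) b =
      MonoidAlgebra.single p 1 * diamondLin lam a b := by
  let m : MonoidAlgebra k (Word X Ω) →ₗ[k] MonoidAlgebra k (Word X Ω) :=
    LinearMap.mulLeft k (MonoidAlgebra.single p 1)
  -- Both sides are linear in `a` with values in linear maps of `b`, so nonempty words suffice for
  -- `a` and arbitrary words for `b`.
  refine LinearMap.congr_fun
    (map_eq_of_mem_supported (f := diamondLin lam ∘ₗ m) (g := (diamondLin lam).compr₂ m) ?_ ha) b
  intro w hw
  refine linearMap_ext_single fun v => ?_
  simp only [LinearMap.comp_apply, LinearMap.compr₂_apply, m, LinearMap.mulLeft_apply,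
    MonoidAlgebra.single_mul_single, one_mul]
  obtain ⟨q, c, rfl⟩ := word_eq_concat hw
  by_cases hv : v = 1
  · subst hv
    rw [diamondLin_one_right, diamondLin_one_right, MonoidAlgebra.single_mul_single, one_mul]
  · obtain ⟨d, r, rfl⟩ := word_eq_cons hv
    rw [← mul_assoc, diamondLin_single_concat, diamondLin_single_concat, ← mul_assoc, ← mul_assoc,
      MonoidAlgebra.single_mul_single, one_mul]

theorem diamondLin_mul_single (q : Word X Ω) (a : MonoidAlgebra k (Word X Ω))
    {b : MonoidAlgebra k (Word X Ω)} (hb : b ∈ nonemptySpan k X Ω) :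
    diamondLin lam a (b * MonoidAlgebra.single q 1) =
      diamondLin lam a b * MonoidAlgebra.single q 1 := by
  let m : MonoidAlgebra k (Word X Ω) →ₗ[k] MonoidAlgebra k (Word X Ω) :=
    LinearMap.mulRight k (MonoidAlgebra.single q 1)
  refine LinearMap.congr_fun (map_eq_of_mem_supported (f := (diamondLin lam).flip ∘ₗ m)
    (g := (diamondLin lam).flip.compr₂ m) ?_ hb) a
  intro w hw
  refine linearMap_ext_single fun v => ?_
  simp only [LinearMap.comp_apply, LinearMap.compr₂_apply, m, LinearMap.mulRight_apply,
    LinearMap.flip_apply, MonoidAlgebra.single_mul_single, one_mul]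
  obtain ⟨d, r, rfl⟩ := word_eq_cons hw
  by_cases hv : v = 1
  · subst hv
    rw [diamondLin_one_left, diamondLin_one_left, MonoidAlgebra.single_mul_single, one_mul]
  · obtain ⟨p, c, rfl⟩ := word_eq_concat hv
    rw [mul_assoc (FreeMonoid.of d), diamondLin_single_concat, diamondLin_single_concat, mul_assoc,
      mul_assoc, mul_assoc, MonoidAlgebra.single_mul_single, one_mul]

/-- A variable never interacts with a neighbouring letter, so multiplying by it is concatenation,
even with the empty word. -/
theorem diamondLin_var_left (x : X) (b : MonoidAlgebra k (Word X Ω)) :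
    diamondLin lam (MonoidAlgebra.single (FreeMonoid.of (.var x)) 1) b =
      MonoidAlgebra.single (FreeMonoid.of (.var x)) 1 * b := by
  refine LinearMap.congr_fun (g := LinearMap.mulLeft k _) (linearMap_ext_single fun v => ?_) b
  rw [LinearMap.mulLeft_apply]
  by_cases hv : v = 1
  · subst hv
    rw [diamondLin_one_right, ← MonoidAlgebra.one_def, mul_one]
  · obtain ⟨d, r, rfl⟩ := word_eq_cons hv
    have := diamondLin_single_concat lam 1 r (.var x) d
    rw [one_mul, ← MonoidAlgebra.one_def, one_mul] at this
    rw [this, diamondLetter_var_left, MonoidAlgebra.single_mul_single,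
      MonoidAlgebra.single_mul_single, mul_assoc]

theorem diamondLin_var_right (x : X) (a : MonoidAlgebra k (Word X Ω)) :
    diamondLin lam a (MonoidAlgebra.single (FreeMonoid.of (.var x)) 1) =
      a * MonoidAlgebra.single (FreeMonoid.of (.var x)) 1 := by
  refine LinearMap.congr_fun (f := (diamondLin lam).flip _) (g := LinearMap.mulRight k _)
    (linearMap_ext_single fun v => ?_) a
  rw [LinearMap.mulRight_apply, LinearMap.flip_apply]
  by_cases hv : v = 1
  · subst hv
    rw [diamondLin_one_left, ← MonoidAlgebra.one_def, one_mul]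
  · obtain ⟨p, c, rfl⟩ := word_eq_concat hv
    have := diamondLin_single_concat lam p 1 c (.var x)
    rw [mul_one, ← MonoidAlgebra.one_def, mul_one] at this
    rw [this, diamondLetter_var_right, MonoidAlgebra.single_mul_single,
      MonoidAlgebra.single_mul_single, mul_assoc]

/-- On basis words this is the recursive clause for two bracket letters, and both sides are
bilinear. No restriction to matching Rota-Baxter words is needed. -/
theorem diamondLin_bracketLin (α β : Ω) (x y : MonoidAlgebra k (Word X Ω)) :
    diamondLin lam (bracketLin k α x) (bracketLin k β y) =
      bracketLin k α (diamondLin lam x (bracketLin k β y)) +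
        bracketLin k β (diamondLin lam (bracketLin k α x) y) +
        lam β • bracketLin k α (diamondLin lam x y) := by
  let D := diamondLin (X := X) lam
  let P := bracketLin (X := X) k α
  let Q := bracketLin (X := X) k β
  suffices h : D.compl₁₂ P Q = (D.compl₁₂ .id Q).compr₂ P + (D.compl₁₂ P .id).compr₂ Q +
      lam β • D.compr₂ P from LinearMap.congr_fun (LinearMap.congr_fun h x) y
  refine linearMap_ext_single fun s => linearMap_ext_single fun t => ?_
  simp only [LinearMap.add_apply, LinearMap.smul_apply, LinearMap.compl₁₂_apply,
    LinearMap.compr₂_apply, LinearMap.id_apply, D, P, Q, bracketLin_single]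
  rw [bracket, bracket, diamondLin_single_of, diamondLetter]
  simp only [diamondLin_single]
  rfl

-- Associativity by induction on the degree.

theorem degList_append (u v : List (Letter X Ω)) :
    Letter.degList (u ++ v) = Letter.degList u + Letter.degList v := by
  induction u with
  | nil => simp [Letter.degList]
  | cons a u ih => rw [List.cons_append, Letter.degList, Letter.degList, ih, add_assoc]

theorem degList_mul (u v : Word X Ω) :
    Letter.degList (u * v).toList = Letter.degList u.toList + Letter.degList v.toList :=
  degList_append _ _

theorem degList_of (a : Letter X Ω) : Letter.degList (FreeMonoid.of a).toList = a.deg := by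
  simp [Letter.degList]

/-- If one of the letters is a variable, some product is a plain concatenation and outer factors can
be moved. For three brackets, both sides expand by the Rota-Baxter relation into products in which
at least one bracket has been removed, where associativity is known. -/
theorem diamondLin_letter_assoc {n : ℕ}
    (ih : ∀ u v w : Word X Ω,
      Letter.degList u.toList + Letter.degList v.toList + Letter.degList w.toList < n →
      diamondLin lam (diamondLin lam (MonoidAlgebra.single u 1) (MonoidAlgebra.single v 1))
          (MonoidAlgebra.single w 1) =
        diamondLin lam (MonoidAlgebra.single u 1)
          (diamondLin lam (MonoidAlgebra.single v 1) (MonoidAlgebra.single w (1 : k))))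
    (a b c : Letter X Ω) (h : a.deg + b.deg + c.deg ≤ n) :
    diamondLin lam (diamondLetter lam a b) (MonoidAlgebra.single (FreeMonoid.of c) 1) =
      diamondLin lam (MonoidAlgebra.single (FreeMonoid.of a) 1)
        (diamondLetter lam b c : MonoidAlgebra k (Word X Ω)) := by
  have hne : ∀ d : Letter X Ω,
      MonoidAlgebra.single (FreeMonoid.of d) (1 : k) ∈ nonemptySpan k X Ω :=
    fun d => single_mem_supported (by simp)
  cases a with
  | var x =>
    rw [diamondLin_var_left, diamondLetter_var_left,
      ← diamondLin_single_of lam b c, ← diamondLin_single_mul lam _ (hne b),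
      MonoidAlgebra.single_mul_single, one_mul]
  | br α s =>
  cases c with
  | var y =>
    rw [diamondLin_var_right, diamondLetter_var_right,
      ← diamondLin_single_of lam _ b, ← diamondLin_mul_single lam _ _ (hne b),
      MonoidAlgebra.single_mul_single, one_mul]
  | br γ u =>
  cases b with
  | var z =>
    rw [diamondLetter_var_right, diamondLetter_var_left]
    have h1 := diamondLin_single_mul lam (FreeMonoid.of (.br α s)) (hne (.var z))
      (MonoidAlgebra.single (FreeMonoid.of (.br γ u)) 1)
    have h2 := diamondLin_mul_single lam (FreeMonoid.of (.br γ u))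
      (MonoidAlgebra.single (FreeMonoid.of (.br α s)) 1) (hne (.var z))
    rw [diamondLin_var_left, MonoidAlgebra.single_mul_single, one_mul] at h1
    rw [diamondLin_var_right, MonoidAlgebra.single_mul_single, one_mul] at h2
    rw [h1, h2, mul_assoc]
  | br β t =>
    simp only [Letter.deg] at h
    rw [← diamondLin_single_of, ← diamondLin_single_of]
    have hP : ∀ (ω : Ω) (r : List (Letter X Ω)),
        MonoidAlgebra.single (FreeMonoid.of (.br ω r)) (1 : k) =
          bracketLin k ω (MonoidAlgebra.single (FreeMonoid.ofList r) 1) :=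
      fun ω r => (bracketLin_single ω (FreeMonoid.ofList r)).symm
    -- The seven triples obtained by opening a nonempty set of the three brackets; each opening
    -- lowers the total degree by one.
    have e1 := ih (.ofList s) (.of (.br β t)) (.of (.br γ u))
      (by simp [Letter.degList, Letter.deg]; omega)
    have e2 := ih (.of (.br α s)) (.ofList t) (.of (.br γ u))
      (by simp [Letter.degList, Letter.deg]; omega)
    have e3 := ih (.of (.br α s)) (.of (.br β t)) (.ofList u)
      (by simp [Letter.degList, Letter.deg]; omega)
    have e4 := ih (.ofList s) (.ofList t) (.of (.br γ u))
      (by simp [Letter.degList, Letter.deg]; omega)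
    have e5 := ih (.ofList s) (.of (.br β t)) (.ofList u)
      (by simp [Letter.degList, Letter.deg]; omega)
    have e6 := ih (.of (.br α s)) (.ofList t) (.ofList u)
      (by simp [Letter.degList, Letter.deg]; omega)
    have e7 := ih (.ofList s) (.ofList t) (.ofList u) (by simp; omega)
    simp only [hP] at e1 e2 e3 e4 e5 e6 e7 ⊢
    generalize MonoidAlgebra.single (FreeMonoid.ofList s) (1 : k) = x at *
    generalize MonoidAlgebra.single (FreeMonoid.ofList t) (1 : k) = y at *
    generalize MonoidAlgebra.single (FreeMonoid.ofList u) (1 : k) = z at *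
    -- In `e1` and `e3` two adjacent factors are still brackets, so these two are expanded as well;
    -- in the other five no such pair is multiplied.
    simp only [map_add, map_smul, LinearMap.add_apply, LinearMap.smul_apply,
      diamondLin_bracketLin lam] at e1 e3 ⊢
    -- `e3` is used backwards: its expanded left side is what appears, under the outer bracket of
    -- index `γ`, in the expansion of the left side of the goal.
    simp only [e1, e2, ← e3, e4, e5, e6, e7, map_add, map_smul]
    module

theorem diamondLin_mul_left (p : MonoidAlgebra k (Word X Ω)) {a : MonoidAlgebra k (Word X Ω)}
    (ha : a ∈ nonemptySpan k X Ω) (b : MonoidAlgebra k (Word X Ω)) :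
    diamondLin lam (p * a) b = p * diamondLin lam a b :=
  LinearMap.congr_fun (f := (diamondLin lam).flip b ∘ₗ LinearMap.mulRight k a)
    (g := LinearMap.mulRight k (diamondLin lam a b))
    (linearMap_ext_single fun w => diamondLin_single_mul lam w ha b) p

theorem diamondLin_mul_right (a : MonoidAlgebra k (Word X Ω)) {b : MonoidAlgebra k (Word X Ω)}
    (hb : b ∈ nonemptySpan k X Ω) (q : MonoidAlgebra k (Word X Ω)) :
    diamondLin lam a (b * q) = diamondLin lam a b * q :=
  LinearMap.congr_fun (f := diamondLin lam a ∘ₗ LinearMap.mulLeft k b)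
    (g := LinearMap.mulLeft k (diamondLin lam a b))
    (linearMap_ext_single fun w => diamondLin_mul_single lam w a hb) q

/-- The products take place at the last letter of `u`, the two ends of `v` and the first letter of
`w`; everything else is carried along by concatenation. -/
theorem diamondLin_single_assoc (n : ℕ) : ∀ u v w : Word X Ω,
    Letter.degList u.toList + Letter.degList v.toList + Letter.degList w.toList ≤ n →
    diamondLin lam (diamondLin lam (MonoidAlgebra.single u 1) (MonoidAlgebra.single v 1))
        (MonoidAlgebra.single w 1) =
      diamondLin lam (MonoidAlgebra.single u 1)
        (diamondLin lam (MonoidAlgebra.single v 1) (MonoidAlgebra.single w (1 : k))) := by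
  induction n using Nat.strong_induction_on with
  | _ n ih =>
  intro u v w hn
  have hne : ∀ d : Letter X Ω,
      MonoidAlgebra.single (FreeMonoid.of d) (1 : k) ∈ nonemptySpan k X Ω :=
    fun d => single_mem_supported (by simp)
  have hmul : ∀ s t : Word X Ω, MonoidAlgebra.single (s * t) (1 : k) =
      MonoidAlgebra.single s 1 * MonoidAlgebra.single t 1 := fun s t => by
    rw [MonoidAlgebra.single_mul_single, one_mul]
  by_cases hu : u = 1
  · rw [hu, diamondLin_one_left, diamondLin_one_left]
  by_cases hv : v = 1
  · rw [hv, diamondLin_one_left, diamondLin_one_right]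
  by_cases hw : w = 1
  · rw [hw, diamondLin_one_right, diamondLin_one_right]
  obtain ⟨p, a, rfl⟩ := word_eq_concat hu
  obtain ⟨c, q, rfl⟩ := word_eq_cons hw
  obtain ⟨b, r, rfl⟩ := word_eq_cons hv
  simp only [degList_mul, degList_of] at hn
  -- If the middle word has one letter, both products involve it, and after removing `p` and `q` the
  -- statement is about three letters. Otherwise they act on different letters `b` and `b'`, and
  -- associativity of concatenation suffices.
  by_cases hr : r = 1
  · subst hr
    rw [mul_one, hmul p, hmul _ q, diamondLin_mul_left lam _ (hne a),
      diamondLin_mul_right lam _ (hne c), diamondLin_mul_right lam _ (hne c), diamondLin_single_of,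
      diamondLin_single_of, diamondLin_mul_left lam _ (diamondLetter_mem_nonemptySpan lam a b),
      diamondLin_mul_right lam _ (diamondLetter_mem_nonemptySpan lam b c),
      diamondLin_mul_left lam _ (hne a), diamondLin_letter_assoc lam
        (fun s t u h => ih _ h s t u le_rfl) a b c (by omega)]
  · obtain ⟨m, b', rfl⟩ := word_eq_concat hr
    rw [hmul p, hmul _ q, hmul (.of b), hmul m]
    rw [diamondLin_mul_left lam _ (hne a), diamondLin_mul_right lam _ (hne b),
      ← mul_assoc, ← mul_assoc, diamondLin_mul_left lam _ (hne b'), ← mul_assoc,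
      diamondLin_mul_left lam _ (hne b'), mul_assoc _ (MonoidAlgebra.single m 1),
      mul_assoc (MonoidAlgebra.single (FreeMonoid.of b) (1 : k)),
      diamondLin_mul_right lam _ (hne b), diamondLin_mul_left lam _ (hne a)]

/-- The module `k M(X, Ω)` with the product `⋄` and the bracket operators. -/
noncomputable def diamondAlgebra : OperatedData k Ω (MonoidAlgebra k (Word X Ω)) where
  mul := diamondLin lam
  one := MonoidAlgebra.single 1 1
  op := bracketLin k

/-- Both sides are trilinear, so one argument at a time is reduced to a basis word. -/
theorem diamondLin_assoc (a b c : MonoidAlgebra k (Word X Ω)) :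
    diamondLin lam (diamondLin lam a b) c = diamondLin lam a (diamondLin lam b c) := by
  let D := diamondLin (X := X) lam
  refine LinearMap.congr_fun (f := D.flip c ∘ₗ D.flip b) (g := D.flip (D b c))
    (linearMap_ext_single fun u => ?_) a
  refine LinearMap.congr_fun (f := D.flip c ∘ₗ D (.single u 1)) (g := D (.single u 1) ∘ₗ D.flip c)
    (linearMap_ext_single fun v => ?_) b
  refine LinearMap.congr_fun (f := D (D (.single u 1) (.single v 1)))
    (g := D (.single u 1) ∘ₗ D (.single v 1)) (linearMap_ext_single fun w => ?_) c
  exact diamondLin_single_assoc lam _ u v w le_rfl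

theorem isMatchingRotaBaxter_diamondAlgebra :
    IsMatchingRotaBaxter lam (diamondAlgebra (X := X) lam) where
  one_mul := diamondLin_one_left lam
  mul_one := diamondLin_one_right lam
  mul_assoc := diamondLin_assoc lam
  rota_baxter := diamondLin_bracketLin lam

end Diamond
/-! ### Evaluation of bracketed words in operated algebras -/

section Eval

variable {k X Ω A : Type*} [CommRing k] [AddCommGroup A] [Module k A]

mutual
/-- The value of a letter in an operated algebra, given the values of the variables. -/
noncomputable def evalLetter (E : OperatedData k Ω A) (f : X → A) : Letter X Ω → A
  | .var x => f x
  | .br ω w => E.op ω (evalList E f w)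
/-- The value of a list of letters. -/
noncomputable def evalList (E : OperatedData k Ω A) (f : X → A) : List (Letter X Ω) → A
  | [] => E.one
  | a :: w => E.mul (evalLetter E f a) (evalList E f w)
end

/-- The linear extension of the evaluation of bracketed words. -/
noncomputable def eval (E : OperatedData k Ω A) (f : X → A) :
    MonoidAlgebra k (Word X Ω) →ₗ[k] A :=
  linExt k fun w => evalList E f w.toList

/-- The algebra `k M(X, Ω)` with concatenation and the bracket operators. -/
noncomputable def wordAlgebra (k X Ω : Type*) [CommRing k] :
    OperatedData k Ω (MonoidAlgebra k (Word X Ω)) :=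
  OperatedData.ofAlgebra (bracketLin k)

variable {E : OperatedData k Ω A} (f : X → A)

theorem eval_single (w : Word X Ω) :
    eval E f (MonoidAlgebra.single w 1) = evalList E f w.toList :=
  linExt_single _ _ _

theorem evalList_append (hE : IsOperatedAlgebra E) (u v : List (Letter X Ω)) :
    evalList E f (u ++ v) = E.mul (evalList E f u) (evalList E f v) := by
  induction u with
  | nil => rw [List.nil_append, evalList, hE.one_mul]
  | cons a u ih => rw [List.cons_append, evalList, evalList, ih, hE.mul_assoc]

theorem eval_mul (hE : IsOperatedAlgebra E) (a b : MonoidAlgebra k (Word X Ω)) :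
    eval E f (a * b) = E.mul (eval E f a) (eval E f b) := by
  refine LinearMap.congr_fun (f := eval E f ∘ₗ LinearMap.mulRight k b)
    (g := E.mul.flip (eval E f b) ∘ₗ eval E f) (linearMap_ext_single fun u => ?_) a
  refine LinearMap.congr_fun (f := eval E f ∘ₗ LinearMap.mulLeft k (.single u 1))
    (g := E.mul (eval E f (.single u 1)) ∘ₗ eval E f) (linearMap_ext_single fun v => ?_) b
  simp only [LinearMap.comp_apply, LinearMap.mulLeft_apply, MonoidAlgebra.single_mul_single,
    one_mul, eval_single]
  exact evalList_append f hE u.toList v.toList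

theorem eval_bracketLin (hE : IsOperatedAlgebra E) (ω : Ω) (a : MonoidAlgebra k (Word X Ω)) :
    eval E f (bracketLin k ω a) = E.op ω (eval E f a) := by
  refine LinearMap.congr_fun (f := eval E f ∘ₗ bracketLin k ω) (g := E.op ω ∘ₗ eval E f)
    (linearMap_ext_single fun w => ?_) a
  rw [LinearMap.comp_apply, LinearMap.comp_apply, bracketLin_single, eval_single, eval_single]
  -- A one-letter word is evaluated as the value of its letter times the unit, which is where the
  -- right unit law enters.
  change E.mul (evalLetter E f (.br ω w.toList)) (evalList E f []) = _
  rw [evalList, evalLetter, hE.mul_one]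

theorem isOperatedHom_eval (hE : IsOperatedAlgebra E) :
    IsOperatedHom (wordAlgebra k X Ω) E (eval E f) where
  map_mul := eval_mul f hE
  map_one := by
    change eval E f (MonoidAlgebra.single 1 1) = _
    rw [eval_single]
    exact evalList.eq_1 E f
  map_op := eval_bracketLin f hE

theorem eval_var (hE : IsOperatedAlgebra E) (x : X) :
    eval E f (MonoidAlgebra.single (varWord Ω x) 1) = f x := by
  rw [eval_single]
  change evalList E f [.var x] = _
  rw [evalList, evalList, evalLetter, hE.mul_one]

mutual
theorem map_single_letter {φ : MonoidAlgebra k (Word X Ω) →ₗ[k] A}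
    (hφ : IsOperatedHom (wordAlgebra k X Ω) E φ) : ∀ a : Letter X Ω,
    φ (MonoidAlgebra.single (FreeMonoid.of a) 1) =
      evalLetter E (fun x => φ (MonoidAlgebra.single (varWord Ω x) 1)) a
  | .var x => by rw [evalLetter]; rfl
  | .br ω w => by
    rw [evalLetter, ← map_single_list hφ w, ← hφ.map_op]
    exact congrArg φ (bracketLin_single ω _).symm
theorem map_single_list {φ : MonoidAlgebra k (Word X Ω) →ₗ[k] A}
    (hφ : IsOperatedHom (wordAlgebra k X Ω) E φ) : ∀ w : List (Letter X Ω),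
    φ (MonoidAlgebra.single (FreeMonoid.ofList w) 1) =
      evalList E (fun x => φ (MonoidAlgebra.single (varWord Ω x) 1)) w
  | [] => by rw [evalList]; exact hφ.map_one
  | a :: w => by
    rw [evalList, ← map_single_letter hφ a, ← map_single_list hφ w, ← hφ.map_mul]
    exact congrArg φ (single_of_mul a (FreeMonoid.ofList w))
end

/-- Variables, brackets and concatenation generate all words, so a homomorphism is determined by its
values on the variables: the uniqueness half of freeness among operated algebras. -/
theorem eq_eval {φ : MonoidAlgebra k (Word X Ω) →ₗ[k] A}
    (hφ : IsOperatedHom (wordAlgebra k X Ω) E φ) :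
    φ = eval E fun x => φ (MonoidAlgebra.single (varWord Ω x) 1) :=
  linearMap_ext_single fun w => by
    rw [eval_single]
    exact map_single_list hφ w.toList

end Eval

/-! ### The ideal generated by the matching Rota-Baxter relations -/

section Ideal

variable {k X Ω A : Type*} [CommRing k] [AddCommGroup A] [Module k A] (lam : Ω → k)

theorem rbRelations_subset_rbIdeal : rbRelations X lam ⊆ rbIdeal X lam := by
  intro s hs
  exact Submodule.mem_sInf.2 fun I hI => hI.1 hs

theorem mul_mem_rbIdeal_left (b : MonoidAlgebra k (Word X Ω)) {a : MonoidAlgebra k (Word X Ω)}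
    (ha : a ∈ rbIdeal X lam) : b * a ∈ rbIdeal X lam :=
  Submodule.mem_sInf.2 fun I hI => (hI.2.1 a b (Submodule.mem_sInf.1 ha I hI)).1

theorem mul_mem_rbIdeal_right (b : MonoidAlgebra k (Word X Ω)) {a : MonoidAlgebra k (Word X Ω)}
    (ha : a ∈ rbIdeal X lam) : a * b ∈ rbIdeal X lam :=
  Submodule.mem_sInf.2 fun I hI => (hI.2.1 a b (Submodule.mem_sInf.1 ha I hI)).2

theorem bracketLin_mem_rbIdeal (ω : Ω) {a : MonoidAlgebra k (Word X Ω)}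
    (ha : a ∈ rbIdeal X lam) : bracketLin k ω a ∈ rbIdeal X lam :=
  Submodule.mem_sInf.2 fun I hI => hI.2.2 ω a (Submodule.mem_sInf.1 ha I hI)

/-- The kernel is an ideal stable under the brackets, and it contains the relations because they
hold in `E`; so it is one of the ideals intersected in `rbIdeal`. -/
theorem rbIdeal_le_ker {E : OperatedData k Ω A} (hE : IsMatchingRotaBaxter lam E)
    {φ : MonoidAlgebra k (Word X Ω) →ₗ[k] A} (hφ : IsOperatedHom (wordAlgebra k X Ω) E φ) :
    rbIdeal X lam ≤ LinearMap.ker φ := by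
  have hmul : ∀ a b, φ (a * b) = E.mul (φ a) (φ b) := hφ.map_mul
  have hop : ∀ ω a, φ (bracketLin k ω a) = E.op ω (φ a) := hφ.map_op
  refine sInf_le ⟨?_, ?_, ?_⟩
  · rintro _ ⟨α, β, x, y, rfl⟩
    have hs : ∀ s t : Word X Ω, MonoidAlgebra.single (s * t) (1 : k) =
        MonoidAlgebra.single s 1 * MonoidAlgebra.single t 1 := fun s t => by
      rw [MonoidAlgebra.single_mul_single, one_mul]
    simp only [← bracketLin_single, hs, SetLike.mem_coe, LinearMap.mem_ker, map_sub, map_smul,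
      hmul, hop, hE.rota_baxter]
    abel
  · intro a b ha
    rw [LinearMap.mem_ker] at ha
    simp [LinearMap.mem_ker, hmul, ha]
  · intro ω a ha
    rw [LinearMap.mem_ker] at ha
    rw [LinearMap.mem_ker, hop, ha, map_zero]

/-- Modulo Id(S) the bracket relation holds for concatenation too, so each step of the recursion for
`⋄` agrees with concatenation, by induction on the degree. -/
theorem diamondWord_sub_mem_rbIdeal (n : ℕ) : ∀ u v : List (Letter X Ω),
    Letter.degList u + Letter.degList v ≤ n →
    diamondWord lam u v - MonoidAlgebra.single (FreeMonoid.ofList u * FreeMonoid.ofList v) 1 ∈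
      rbIdeal X lam := by
  induction n using Nat.strong_induction_on with
  | _ n ih =>
  intro u v hn
  rcases List.eq_nil_or_concat' u with rfl | ⟨p, a, rfl⟩
  · rw [diamondWord_nil_left, FreeMonoid.ofList_nil, one_mul, sub_self]
    exact zero_mem _
  rcases v with _ | ⟨b, q⟩
  · rw [diamondWord_nil_right, FreeMonoid.ofList_nil, mul_one, sub_self]
    exact zero_mem _
  have key : diamondLetter lam a b -
      MonoidAlgebra.single (FreeMonoid.of a * FreeMonoid.of b) 1 ∈ rbIdeal X lam := by
    by_cases h : a.IsBr ∧ b.IsBr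
    · cases a with
      | var x => exact h.1.elim
      | br α s =>
      cases b with
      | var y => exact h.2.elim
      | br β t =>
        rw [degList_append] at hn
        simp only [Letter.degList, Letter.deg] at hn
        have e1 := bracketLin_mem_rbIdeal lam α (ih (n - 1) (by omega) s [.br β t]
          (by simp only [Letter.degList, Letter.deg]; omega))
        have e2 := bracketLin_mem_rbIdeal lam β (ih (n - 1) (by omega) [.br α s] t
          (by simp only [Letter.degList, Letter.deg]; omega))
        have e3 := bracketLin_mem_rbIdeal lam α (ih (n - 1) (by omega) s t (by omega))
        have e4 := rbRelations_subset_rbIdeal lam ⟨α, β, .ofList s, .ofList t, rfl⟩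
        -- By induction, each `⋄` inside the three brackets may be replaced by concatenation; what
        -- then remains is exactly the negative of the relation `e4`.
        have e5 := sub_mem (add_mem (add_mem e1 e2) (Submodule.smul_mem _ (lam β) e3)) e4
        rw [diamondLetter]
        convert e5 using 1
        have hb : ∀ (ω : Ω) (r : List (Letter X Ω)),
            bracket ω (FreeMonoid.ofList r) = FreeMonoid.ofList [.br ω r] := fun _ _ => rfl
        simp only [map_sub, bracketLin_single, smul_sub, hb, FreeMonoid.ofList_singleton]
        abel
    · rw [diamondLetter_of_not_isBr lam h, sub_self]
      exact zero_mem _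
  have := mul_mem_rbIdeal_right lam (MonoidAlgebra.single (FreeMonoid.ofList q) 1)
    (mul_mem_rbIdeal_left lam (MonoidAlgebra.single (FreeMonoid.ofList p) 1) key)
  rw [mul_sub, sub_mul, MonoidAlgebra.single_mul_single, MonoidAlgebra.single_mul_single,
    one_mul, one_mul] at this
  rw [diamondWord_concat_cons]
  convert this using 3
  simp [FreeMonoid.ofList_append, FreeMonoid.ofList_cons, mul_assoc]

theorem diamondLin_sub_mul_mem_rbIdeal (a b : MonoidAlgebra k (Word X Ω)) :
    diamondLin lam a b - a * b ∈ rbIdeal X lam := by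
  refine map₂_mem_of_mem_supported (S := Set.univ) (T := Set.univ)
    (diamondLin lam - LinearMap.mul k _) (fun u _ v _ => ?_) (fun _ _ => trivial)
    (fun _ _ => trivial)
  rw [LinearMap.sub_apply, LinearMap.sub_apply, LinearMap.mul_apply', diamondLin_single,
    MonoidAlgebra.single_mul_single, one_mul]
  exact diamondWord_sub_mem_rbIdeal lam _ _ _ le_rfl

/-- `φ` kills Id(S), hence does not distinguish `a ⋄ b` from `a * b`. -/
theorem IsOperatedHom.of_wordAlgebra {E : OperatedData k Ω A} (hE : IsMatchingRotaBaxter lam E)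
    {φ : MonoidAlgebra k (Word X Ω) →ₗ[k] A} (hφ : IsOperatedHom (wordAlgebra k X Ω) E φ) :
    IsOperatedHom (diamondAlgebra lam) E φ where
  map_mul a b := by
    have := rbIdeal_le_ker lam hE hφ (diamondLin_sub_mul_mem_rbIdeal lam a b)
    rw [LinearMap.mem_ker, map_sub, sub_eq_zero] at this
    exact this.trans (hφ.map_mul a b)
  map_one := hφ.map_one
  map_op := hφ.map_op

end Ideal

/-! ### The normal form -/

section NormalForm

variable {k X Ω : Type*} [CommRing k] (lam : Ω → k)

/-- The homomorphism from the bracketed words with concatenation to the bracketed words with the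
product `⋄`, which is the identity on the variables. -/
noncomputable def normalForm : MonoidAlgebra k (Word X Ω) →ₗ[k] MonoidAlgebra k (Word X Ω) :=
  eval (diamondAlgebra lam) fun x => MonoidAlgebra.single (varWord Ω x) 1

theorem isOperatedHom_normalForm :
    IsOperatedHom (wordAlgebra k X Ω) (diamondAlgebra lam) (normalForm lam) :=
  isOperatedHom_eval _ (isMatchingRotaBaxter_diamondAlgebra lam).toIsOperatedAlgebra

theorem normalForm_mul (a b : MonoidAlgebra k (Word X Ω)) :
    normalForm lam (a * b) = diamondLin lam (normalForm lam a) (normalForm lam b) :=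
  (isOperatedHom_normalForm lam).map_mul a b

theorem normalForm_bracketLin (ω : Ω) (a : MonoidAlgebra k (Word X Ω)) :
    normalForm lam (bracketLin k ω a) = bracketLin k ω (normalForm lam a) :=
  (isOperatedHom_normalForm lam).map_op ω a

theorem normalForm_one :
    normalForm lam (MonoidAlgebra.single 1 1) = MonoidAlgebra.single (1 : Word X Ω) (1 : k) :=
  (isOperatedHom_normalForm lam).map_one

theorem normalForm_var (x : X) : normalForm lam (MonoidAlgebra.single (varWord Ω x) 1) =
    MonoidAlgebra.single (varWord Ω x) (1 : k) :=
  eval_var _ (isMatchingRotaBaxter_diamondAlgebra lam).toIsOperatedAlgebra x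

/-- Letters are nested through lists, so the induction runs on the degree, which drops on entering a
bracket and on removing the first letter. -/
theorem word_induction {p : Word X Ω → Prop} (one : p 1) (var : ∀ x, p (varWord Ω x))
    (br : ∀ ω u, p u → p (bracket ω u))
    (mul : ∀ a u, p (FreeMonoid.of a) → p u → p (FreeMonoid.of a * u)) (w : Word X Ω) : p w := by
  have key : ∀ n, ∀ w : List (Letter X Ω), Letter.degList w ≤ n → p (.ofList w) := by
    intro n
    induction n using Nat.strong_induction_on with
    | _ n ih =>
    intro w hn
    rcases w with _ | ⟨a, w⟩
    · exact one
    rw [Letter.degList] at hn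
    have ha : p (FreeMonoid.of a) := by
      cases a with
      | var x => exact var x
      | br ω u =>
        rw [Letter.deg] at hn
        exact br ω (.ofList u) (ih (n - 1) (by omega) u (by omega))
    have hpos : 1 ≤ a.deg := by cases a <;> simp [Letter.deg]
    exact mul a (.ofList w) ha (ih (n - 1) (by omega) w (by omega))
  exact key _ w.toList le_rfl

/-- A matching Rota-Baxter word has no adjacent brackets at any depth, so every `⋄` performed in
evaluating it is a concatenation. -/
theorem normalForm_single_of_isRB (w : Word X Ω) (hw : IsRB w.toList) :
    normalForm lam (MonoidAlgebra.single w 1) = MonoidAlgebra.single w (1 : k) := by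
  induction w using word_induction with
  | one => exact normalForm_one lam
  | var x => exact normalForm_var lam x
  | br ω u ih =>
    rw [← bracketLin_single, normalForm_bracketLin, ih (isRB_br.1 hw)]
  | mul a u iha ihu =>
    obtain ⟨ha, hu, h⟩ := IsRB.of_append (u := [a]) (v := u.toList) hw
    rw [single_of_mul, normalForm_mul, iha ha, ihu hu]
    by_cases h1 : u = 1
    · rw [h1, diamondLin_one_right, ← MonoidAlgebra.one_def, mul_one]
    · obtain ⟨b, q, rfl⟩ := word_eq_cons h1
      have := diamondLin_single_concat lam 1 q a b
      rw [one_mul] at this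
      rw [this, diamondLetter_of_not_isBr lam (h a (by simp) b (by simp)),
        ← MonoidAlgebra.one_def, one_mul, MonoidAlgebra.single_mul_single,
        MonoidAlgebra.single_mul_single, mul_assoc]

theorem normalForm_of_mem {a : MonoidAlgebra k (Word X Ω)} (ha : a ∈ rbWordModule k X Ω) :
    normalForm lam a = a :=
  map_eq_of_mem_supported (g := LinearMap.id)
    (fun w hw => normalForm_single_of_isRB lam w (mem_rbWords_iff.1 hw)) ha

theorem bracketLin_mem_rbWordModule (ω : Ω) {a : MonoidAlgebra k (Word X Ω)}
    (ha : a ∈ rbWordModule k X Ω) : bracketLin k ω a ∈ rbWordModule k X Ω :=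
  map_mem_of_mem_supported _ (fun w hw => by
    rw [bracketLin_single]
    exact single_mem_supported (mem_rbWords_iff.2 (isRB_br.2 (mem_rbWords_iff.1 hw)))) ha

/-- The variables and the unit lie in k 𝔛_∞, which is closed under `⋄` and the brackets. -/
theorem normalForm_mem (a : MonoidAlgebra k (Word X Ω)) :
    normalForm lam a ∈ rbWordModule k X Ω := by
  refine map_mem_of_forall_single _ (fun w => ?_) a
  induction w using word_induction with
  | one =>
    rw [normalForm_one]
    exact single_mem_supported (mem_rbWords_iff.2 IsRB.nil)
  | var x =>
    rw [normalForm_var]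
    exact single_mem_supported (mem_rbWords_iff.2 (IsRB.var x))
  | br ω u ih =>
    rw [← bracketLin_single, normalForm_bracketLin]
    exact bracketLin_mem_rbWordModule ω ih
  | mul a u iha ihu =>
    rw [single_of_mul, normalForm_mul]
    exact diamondLin_mem lam iha ihu

theorem normalForm_sub_mem_rbIdeal (a : MonoidAlgebra k (Word X Ω)) :
    normalForm lam a - a ∈ rbIdeal X lam := by
  refine map_mem_of_forall_single (normalForm lam - LinearMap.id) (fun w => ?_) a
  rw [LinearMap.sub_apply, LinearMap.id_apply]
  induction w using word_induction with
  | one => rw [normalForm_one, sub_self]; exact zero_mem _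
  | var x => rw [normalForm_var, sub_self]; exact zero_mem _
  | br ω u ih =>
    rw [← bracketLin_single, normalForm_bracketLin, ← map_sub]
    exact bracketLin_mem_rbIdeal lam ω ih
  | mul a u iha ihu =>
    rw [single_of_mul, normalForm_mul]
    generalize MonoidAlgebra.single (FreeMonoid.of a) (1 : k) = x at *
    generalize MonoidAlgebra.single u (1 : k) = y at *
    -- With N for `normalForm`, Nx ⋄ Ny - xy = (Nx ⋄ Ny - Nx Ny) + (Nx - x) Ny + x (Ny - y), and
    -- each summand lies in the ideal.
    have h1 := diamondLin_sub_mul_mem_rbIdeal lam (normalForm lam x) (normalForm lam y)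
    have h2 := mul_mem_rbIdeal_right lam (normalForm lam y) iha
    have h3 := mul_mem_rbIdeal_left lam x ihu
    have := add_mem (add_mem h1 h2) h3
    convert this using 1
    noncomm_ring

theorem isCompl_rbWordModule_rbIdeal : IsCompl (rbWordModule k X Ω) (rbIdeal X lam) := by
  refine ⟨Submodule.disjoint_def.2 fun a ha hb => ?_, codisjoint_iff.2 (eq_top_iff.2 fun a _ => ?_)⟩
  -- An element of the intersection is both fixed and killed by `normalForm`.
  · rw [← normalForm_of_mem lam ha]
    exact rbIdeal_le_ker lam (isMatchingRotaBaxter_diamondAlgebra lam)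
      (isOperatedHom_normalForm lam) hb
  -- The decomposition is a = N a - (N a - a), with N for `normalForm`.
  · refine Submodule.mem_sup.2 ⟨_, normalForm_mem lam a, _,
      neg_mem (normalForm_sub_mem_rbIdeal lam a), ?_⟩
    abel

/-- The projection kills `normalForm lam a - a` and fixes `normalForm lam a`, so it sends `a` to the
latter. -/
theorem coe_phi (h : IsCompl (rbWordModule k X Ω) (rbIdeal X lam))
    (a : MonoidAlgebra k (Word X Ω)) : (phi lam h a : MonoidAlgebra k (Word X Ω)) =
      normalForm lam a := by
  have h1 : phi lam h (normalForm lam a - a) = 0 :=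
    (Submodule.projectionOnto_apply_eq_zero_iff h).2 (normalForm_sub_mem_rbIdeal lam a)
  rw [map_sub, sub_eq_zero] at h1
  rw [← h1, phi, Submodule.projectionOnto_apply_of_mem_left h (normalForm_mem lam a)]

end NormalForm
/-! ### Pulling back structures along injective homomorphisms -/

section Pullback

variable {k Ω A B C : Type*} [CommRing k] [AddCommGroup A] [Module k A]
  [AddCommGroup B] [Module k B] [AddCommGroup C] [Module k C]
  {D : OperatedData k Ω A} {E : OperatedData k Ω B} {G : OperatedData k Ω C}

theorem IsOperatedHom.comp {ψ : B →ₗ[k] C} {φ : A →ₗ[k] B} (hψ : IsOperatedHom E G ψ)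
    (hφ : IsOperatedHom D E φ) : IsOperatedHom D G (ψ ∘ₗ φ) where
  map_mul a b := by simp [hφ.map_mul, hψ.map_mul]
  map_one := by simp [hφ.map_one, hψ.map_one]
  map_op ω a := by simp [hφ.map_op, hψ.map_op]

theorem IsOperatedHom.of_comp {ψ : B →ₗ[k] C} {φ : A →ₗ[k] B} (hψ : IsOperatedHom E G ψ)
    (inj : Function.Injective ψ) (h : IsOperatedHom D G (ψ ∘ₗ φ)) : IsOperatedHom D E φ where
  map_mul a b := inj (by simpa [hψ.map_mul] using h.map_mul a b)
  map_one := inj (by simpa [hψ.map_one] using h.map_one)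
  map_op ω a := inj (by simpa [hψ.map_op] using h.map_op ω a)

theorem IsOperatedAlgebra.of_injective {φ : A →ₗ[k] B} (hφ : IsOperatedHom D E φ)
    (inj : Function.Injective φ) (hE : IsOperatedAlgebra E) : IsOperatedAlgebra D where
  one_mul a := inj (by rw [hφ.map_mul, hφ.map_one, hE.one_mul])
  mul_one a := inj (by rw [hφ.map_mul, hφ.map_one, hE.mul_one])
  mul_assoc a b c := inj (by simp only [hφ.map_mul, hE.mul_assoc])

/-- Identities can be checked after an injective homomorphism. Applied to θ⁻¹, this carries the
axioms from words to forests. -/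
theorem IsMatchingRotaBaxter.of_injective {φ : A →ₗ[k] B} (hφ : IsOperatedHom D E φ)
    (inj : Function.Injective φ) {lam : Ω → k}
    (hE : IsMatchingRotaBaxter lam E) :
    IsMatchingRotaBaxter lam D where
  toIsOperatedAlgebra := .of_injective hφ inj hE.toIsOperatedAlgebra
  rota_baxter α β x y := inj (by
    simp only [hφ.map_mul, hφ.map_op, map_add, map_smul, hE.rota_baxter])

theorem IsOperatedFiltered.comap {φ : A →ₗ[k] B} (hφ : IsOperatedHom D E φ)
    (inj : Function.Injective φ) {F : ℕ → Submodule k B}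
    (hE : IsOperatedFiltered E F) :
    IsOperatedFiltered D fun n => (F n).comap φ where
  toIsOperatedAlgebra := .of_injective hφ inj hE.toIsOperatedAlgebra
  mono _ _ h := Submodule.comap_mono (hE.mono h)
  exhaustive a := hE.exhaustive (φ a)
  one_mem := by
    rw [Submodule.mem_comap, hφ.map_one]
    exact hE.one_mem
  mul_mem p q a b ha hb := by
    rw [Submodule.mem_comap, hφ.map_mul]
    exact hE.mul_mem p q _ _ ha hb
  op_mem ω n a ha := by
    rw [Submodule.mem_comap, hφ.map_op]
    exact hE.op_mem ω n _ ha

end Pullback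

/-! ### Degree filtrations on bracketed words -/

section Filtration

variable {k X Ω : Type*} [CommRing k] (lam : Ω → k)

/-- The degree filtration of `k M(X, Ω)`. -/
noncomputable def wordFiltration (k X Ω : Type*) [CommRing k] (n : ℕ) :
    Submodule k (MonoidAlgebra k (Word X Ω)) :=
  MonoidAlgebra.supported k k {w | Letter.degList w.toList ≤ n}

theorem single_mem_wordFiltration {w : Word X Ω} {n : ℕ} (h : Letter.degList w.toList ≤ n) :
    MonoidAlgebra.single w (1 : k) ∈ wordFiltration k X Ω n :=
  single_mem_supported h

theorem wordFiltration_mono : Monotone (wordFiltration k X Ω) :=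
  fun _ _ h => MonoidAlgebra.supported_mono fun _ hw => le_trans hw h

theorem mul_mem_wordFiltration {p q : ℕ} {a b : MonoidAlgebra k (Word X Ω)}
    (ha : a ∈ wordFiltration k X Ω p) (hb : b ∈ wordFiltration k X Ω q) :
    a * b ∈ wordFiltration k X Ω (p + q) :=
  map₂_mem_of_mem_supported (LinearMap.mul k _) (fun u hu v hv => by
    rw [LinearMap.mul_apply', MonoidAlgebra.single_mul_single, one_mul]
    refine single_mem_wordFiltration ?_
    rw [degList_mul]
    exact add_le_add hu hv) ha hb

theorem bracketLin_mem_wordFiltration (ω : Ω) {n : ℕ} {a : MonoidAlgebra k (Word X Ω)}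
    (ha : a ∈ wordFiltration k X Ω n) : bracketLin k ω a ∈ wordFiltration k X Ω (n + 1) :=
  map_mem_of_mem_supported _ (fun u hu => by
    rw [bracketLin_single]
    refine single_mem_wordFiltration ?_
    rw [bracket, degList_of, Letter.deg]
    exact Nat.succ_le_succ hu) ha

theorem exists_mem_wordFiltration (a : MonoidAlgebra k (Word X Ω)) :
    ∃ n, a ∈ wordFiltration k X Ω n :=
  -- The largest degree among the finitely many words occurring in `a`.
  ⟨a.coeff.support.sup fun w => Letter.degList w.toList, fun _ hw =>
    Finset.le_sup (f := fun w : Word X Ω => Letter.degList w.toList) hw⟩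

/-- In the product of two brackets the first two terms preserve the bound given by the total degree,
and the weight term loses a bracket. So `⋄` respects the filtration without being graded in general.
-/
theorem diamondWord_mem_wordFiltration (n : ℕ) : ∀ u v : List (Letter X Ω),
    Letter.degList u + Letter.degList v ≤ n →
    diamondWord lam u v ∈ wordFiltration k X Ω n := by
  induction n using Nat.strong_induction_on with
  | _ n ih =>
  intro u v hn
  rcases List.eq_nil_or_concat' u with rfl | ⟨p, a, rfl⟩
  · rw [diamondWord_nil_left]
    exact single_mem_wordFiltration (le_trans (Nat.le_add_left _ _) hn)
  rcases v with _ | ⟨b, q⟩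
  · rw [diamondWord_nil_right]
    exact single_mem_wordFiltration (le_trans (Nat.le_add_right _ _) hn)
  have hd : Letter.degList p + (a.deg + b.deg) + Letter.degList q ≤ n := by
    rw [degList_append] at hn
    simp only [Letter.degList] at hn
    omega
  have key : diamondLetter lam a b ∈ wordFiltration k X Ω (a.deg + b.deg) := by
    by_cases h : a.IsBr ∧ b.IsBr
    · cases a with
      | var x => exact h.1.elim
      | br α s =>
      cases b with
      | var y => exact h.2.elim
      | br β t =>
        simp only [Letter.deg] at hd ⊢
        rw [diamondLetter]
        have e1 := bracketLin_mem_wordFiltration α (ih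
          (Letter.degList s + Letter.degList t + 1) (by omega) s [.br β t]
          (by simp only [Letter.degList, Letter.deg]; omega))
        have e2 := bracketLin_mem_wordFiltration β (ih
          (Letter.degList s + Letter.degList t + 1) (by omega) [.br α s] t
          (by simp only [Letter.degList, Letter.deg]; omega))
        have e3 := bracketLin_mem_wordFiltration α (ih
          (Letter.degList s + Letter.degList t + 1) (by omega) s t (by omega))
        exact wordFiltration_mono (by omega)
          (add_mem (add_mem e1 e2) (Submodule.smul_mem _ (lam β) e3))
    · rw [diamondLetter_of_not_isBr lam h]
      refine single_mem_wordFiltration ?_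
      rw [degList_mul, degList_of, degList_of]
  rw [diamondWord_concat_cons]
  exact wordFiltration_mono hd (mul_mem_wordFiltration (mul_mem_wordFiltration
    (single_mem_wordFiltration le_rfl) key) (single_mem_wordFiltration le_rfl))

theorem isOperatedFiltered_wordAlgebra :
    IsOperatedFiltered (wordAlgebra k X Ω) (wordFiltration k X Ω) where
  one_mul a := one_mul a
  mul_one a := mul_one a
  mul_assoc a b c := mul_assoc a b c
  mono := wordFiltration_mono
  exhaustive := exists_mem_wordFiltration
  one_mem := single_mem_wordFiltration (by simp [Letter.degList])
  mul_mem _ _ _ _ := mul_mem_wordFiltration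
  op_mem ω _ _ := bracketLin_mem_wordFiltration ω

theorem isOperatedFiltered_diamondAlgebra :
    IsOperatedFiltered (diamondAlgebra lam) (wordFiltration k X Ω) where
  toIsOperatedAlgebra := (isMatchingRotaBaxter_diamondAlgebra lam).toIsOperatedAlgebra
  mono := wordFiltration_mono
  exhaustive := exists_mem_wordFiltration
  one_mem := single_mem_wordFiltration (by simp [Letter.degList])
  mul_mem p q _ _ ha hb := map₂_mem_of_mem_supported (diamondLin lam) (fun u hu v hv => by
    rw [diamondLin_single]
    exact diamondWord_mem_wordFiltration lam _ _ _ (add_le_add hu hv)) ha hb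
  op_mem ω _ _ := bracketLin_mem_wordFiltration ω

theorem normalForm_mem_wordFiltration {n : ℕ} {a : MonoidAlgebra k (Word X Ω)}
    (ha : a ∈ wordFiltration k X Ω n) : normalForm lam a ∈ wordFiltration k X Ω n := by
  -- The bound `n` is replaced by the exact degree of `w`, so that the induction on words has no
  -- side condition.
  refine map_mem_of_mem_supported _ (fun w hw => wordFiltration_mono hw ?_) ha
  clear hw ha
  induction w using word_induction with
  | one =>
    rw [normalForm_one]
    exact single_mem_wordFiltration le_rfl
  | var x =>
    rw [normalForm_var]
    exact single_mem_wordFiltration le_rfl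
  | br ω u ih =>
    rw [← bracketLin_single, normalForm_bracketLin, bracket, degList_of, Letter.deg]
    exact bracketLin_mem_wordFiltration ω ih
  | mul a u iha ihu =>
    rw [single_of_mul, normalForm_mul, degList_mul]
    exact (isOperatedFiltered_diamondAlgebra lam).mul_mem _ _ _ _ iha ihu

end Filtration

/-! ### Transport to forests -/

section Forests

variable {k X Ω : Type*} [CommRing k] (lam : Ω → k)

-- Degrees, products and operators under θ.

mutual
theorem numVertices_toTree : ∀ a : Letter X Ω, a.toTree.numVertices = a.deg
  | .var x => by simp [Letter.toTree, PTree.numVertices, PTree.numVerticesList, Letter.deg]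
  | .br ω w => by
    rw [Letter.toTree, PTree.numVertices, Letter.deg, numVerticesList_toTreeList w]
theorem numVerticesList_toTreeList : ∀ w : List (Letter X Ω),
    PTree.numVerticesList (Letter.toTreeList w) = Letter.degList w
  | [] => by rw [Letter.toTreeList, PTree.numVerticesList, Letter.degList]
  | a :: w => by
    rw [Letter.toTreeList, PTree.numVerticesList, Letter.degList, numVertices_toTree a,
      numVerticesList_toTreeList w]
end

theorem deg_theta (w : Word X Ω) : (theta X Ω w).deg = Letter.degList w.toList := by
  rw [← numVerticesList_toTreeList, Letter.toTreeList_eq_map]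
  change PTree.numVerticesList (List.map _ (List.map _ w.toList)) = _
  rw [List.map_map]
  rfl

theorem thetaLin_single (w : Word X Ω) :
    thetaLin k X Ω (MonoidAlgebra.single w 1) = MonoidAlgebra.single (theta X Ω w) 1 := by
  simp [thetaLin]

theorem thetaLin_symm_single (F : Forest X Ω) : (thetaLin k X Ω).symm (MonoidAlgebra.single F 1) =
    MonoidAlgebra.single ((theta X Ω).symm F) 1 := by
  rw [LinearEquiv.symm_apply_eq, thetaLin_single, MulEquiv.apply_symm_apply]

theorem graftLin_single (ω : Ω) (F : Forest X Ω) :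
    graftLin k ω (MonoidAlgebra.single F 1) = MonoidAlgebra.single (graft ω F) 1 := by
  rw [graftLin, MonoidAlgebra.mapDomainLinearMap_single]

theorem theta_symm_graft (ω : Ω) (F : Forest X Ω) :
    (theta X Ω).symm (graft ω F) = bracket ω ((theta X Ω).symm F) := by
  rw [MulEquiv.symm_apply_eq, theta_bracket, MulEquiv.apply_symm_apply]

theorem isOperatedHom_thetaLin_symm :
    IsOperatedHom (forestAlgebra k X Ω) (wordAlgebra k X Ω) (thetaLin k X Ω).symm.toLinearMap where
  map_mul a b := by
    let e := (thetaLin k X Ω).symm.toLinearMap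
    change e (a * b) = e a * e b
    refine LinearMap.congr_fun (f := e ∘ₗ LinearMap.mulRight k b)
      (g := LinearMap.mulRight k (e b) ∘ₗ e) (linearMap_ext_single fun F => ?_) a
    refine LinearMap.congr_fun (f := e ∘ₗ LinearMap.mulLeft k (.single F 1))
      (g := LinearMap.mulLeft k (e (.single F 1)) ∘ₗ e) (linearMap_ext_single fun G => ?_) b
    simp only [e, LinearMap.comp_apply, LinearMap.mulLeft_apply, LinearEquiv.coe_coe,
      MonoidAlgebra.single_mul_single, one_mul, thetaLin_symm_single, map_mul]
  map_one := by
    change (thetaLin k X Ω).symm (MonoidAlgebra.single 1 1) = MonoidAlgebra.single 1 1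
    rw [thetaLin_symm_single, map_one]
  map_op ω a := by
    refine LinearMap.congr_fun (f := (thetaLin k X Ω).symm.toLinearMap ∘ₗ graftLin k ω)
      (g := bracketLin k ω ∘ₗ (thetaLin k X Ω).symm.toLinearMap)
      (linearMap_ext_single fun F => ?_) a
    simp only [LinearMap.comp_apply, LinearEquiv.coe_coe, graftLin_single, thetaLin_symm_single,
      bracketLin_single, theta_symm_graft]

/-- θ turns the number of variables and brackets into the number of vertices, so the filtration of
forests is pulled back from words. -/
theorem forestFiltration_eq_comap (n : ℕ) : forestFiltration k X Ω n =
    (wordFiltration k X Ω n).comap (thetaLin k X Ω).symm.toLinearMap := by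
  refine le_antisymm (fun a ha => ?_) fun a ha => ?_
  · rw [Submodule.mem_comap]
    refine map_mem_of_mem_supported (thetaLin k X Ω).symm.toLinearMap (fun F hF => ?_) ha
    rw [LinearEquiv.coe_coe, thetaLin_symm_single]
    refine single_mem_wordFiltration ?_
    rw [← deg_theta, MulEquiv.apply_symm_apply]
    exact hF
  · rw [← (thetaLin k X Ω).apply_symm_apply a]
    refine map_mem_of_mem_supported (thetaLin k X Ω).toLinearMap (fun w hw => ?_) ha
    rw [LinearEquiv.coe_coe, thetaLin_single]
    exact single_mem_supported ((deg_theta w).trans_le hw)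

theorem isOperatedFiltered_forestAlgebra :
    IsOperatedFiltered (forestAlgebra k X Ω) (forestFiltration k X Ω) := by
  rw [funext forestFiltration_eq_comap]
  exact .comap isOperatedHom_thetaLin_symm (thetaLin k X Ω).symm.injective
    isOperatedFiltered_wordAlgebra

/-- The embedding `θ⁻¹` of `k 𝔏_∞` into `k M(X, Ω)`. -/
noncomputable def rbForestToWord (k X Ω : Type*) [CommRing k] :
    rbForestModule k X Ω →ₗ[k] MonoidAlgebra k (Word X Ω) :=
  (thetaLin k X Ω).symm.toLinearMap ∘ₗ (rbForestModule k X Ω).subtype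

theorem rbForestToWord_injective : Function.Injective (rbForestToWord k X Ω) :=
  (thetaLin k X Ω).symm.injective.comp Subtype.val_injective

theorem rbForestToWord_thetaRB (a : rbWordModule k X Ω) :
    rbForestToWord k X Ω (thetaRB k X Ω a) = a :=
  (thetaLin k X Ω).symm_apply_apply a.1

theorem coe_thetaRB_symm (a : rbForestModule k X Ω) :
    ((thetaRB k X Ω).symm a : MonoidAlgebra k (Word X Ω)) = rbForestToWord k X Ω a := by
  rw [← rbForestToWord_thetaRB, LinearEquiv.apply_symm_apply]

theorem isOperatedHom_rbForestToWord :
    IsOperatedHom (rbForestAlgebra X lam) (diamondAlgebra lam) (rbForestToWord k X Ω) where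
  map_mul a b := by
    change rbForestToWord k X Ω (thetaRB k X Ω
      (diamondW lam ((thetaRB k X Ω).symm a) ((thetaRB k X Ω).symm b))) = _
    rw [rbForestToWord_thetaRB, ← coe_thetaRB_symm, ← coe_thetaRB_symm]
    rfl
  map_one := isOperatedHom_thetaLin_symm.map_one
  map_op ω a := isOperatedHom_thetaLin_symm.map_op ω a.1

theorem isMatchingRotaBaxter_rbForestAlgebra :
    IsMatchingRotaBaxter lam (rbForestAlgebra X lam) :=
  .of_injective (isOperatedHom_rbForestToWord lam) rbForestToWord_injective
    (isMatchingRotaBaxter_diamondAlgebra lam)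

theorem rbForestFiltration_eq_comap (n : ℕ) : rbForestFiltration k X Ω n =
    (wordFiltration k X Ω n).comap (rbForestToWord k X Ω) := by
  rw [rbForestToWord, Submodule.comap_comp, ← forestFiltration_eq_comap]
  ext a
  -- Both memberships are conditions on the support of `a`, which consists of matching Rota-Baxter
  -- forests already.
  exact ⟨fun h F hF => (h hF).2, fun h F hF => ⟨a.2 hF, h hF⟩⟩

theorem isOperatedFiltered_rbForestAlgebra :
    IsOperatedFiltered (rbForestAlgebra X lam) (rbForestFiltration k X Ω) := by
  rw [funext rbForestFiltration_eq_comap]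
  exact .comap (isOperatedHom_rbForestToWord lam) rbForestToWord_injective
    (isOperatedFiltered_diamondAlgebra lam)

theorem rbForestToWord_dotRB (x : X) :
    rbForestToWord k X Ω (dotRB k Ω x) = MonoidAlgebra.single (varWord Ω x) 1 := by
  change (thetaLin k X Ω).symm (MonoidAlgebra.single (dot Ω x) 1) = _
  rw [thetaLin_symm_single, ← theta_var, MulEquiv.symm_apply_apply]

/-- The homomorphism `θ φ` from bracketed words to matching Rota-Baxter forests. -/
noncomputable def wordToRBForest :
    MonoidAlgebra k (Word X Ω) →ₗ[k] rbForestModule k X Ω :=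
  (thetaRB k X Ω).toLinearMap ∘ₗ (normalForm lam).codRestrict _ (normalForm_mem lam)

theorem rbForestToWord_wordToRBForest (a : MonoidAlgebra k (Word X Ω)) :
    rbForestToWord k X Ω (wordToRBForest lam a) = normalForm lam a :=
  rbForestToWord_thetaRB _

theorem wordToRBForest_rbForestToWord (a : rbForestModule k X Ω) :
    wordToRBForest lam (rbForestToWord k X Ω a) = a :=
  rbForestToWord_injective (by
    rw [rbForestToWord_wordToRBForest, ← coe_thetaRB_symm,
      normalForm_of_mem lam ((thetaRB k X Ω).symm a).2])

/-- Followed by the injective homomorphism θ⁻¹ it becomes `normalForm`, which is a homomorphism. -/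
theorem isOperatedHom_wordToRBForest :
    IsOperatedHom (wordAlgebra k X Ω) (rbForestAlgebra X lam) (wordToRBForest lam) := by
  refine IsOperatedHom.of_comp (isOperatedHom_rbForestToWord lam) rbForestToWord_injective ?_
  rw [show rbForestToWord k X Ω ∘ₗ wordToRBForest lam = normalForm lam from
    LinearMap.ext (rbForestToWord_wordToRBForest lam)]
  exact isOperatedHom_normalForm lam

theorem wordToRBForest_var (x : X) :
    wordToRBForest lam (MonoidAlgebra.single (varWord Ω x) 1) = dotRB k Ω x := by
  rw [← rbForestToWord_dotRB, wordToRBForest_rbForestToWord]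

theorem psi_eq (h : IsCompl (rbWordModule k X Ω) (rbIdeal X lam)) :
    psi lam h = wordToRBForest lam ∘ₗ (thetaLin k X Ω).symm.toLinearMap :=
  LinearMap.ext fun _ => congrArg (thetaRB k X Ω) (Subtype.ext (coe_phi lam h _))

theorem isOperatedFilteredHom_psi (h : IsCompl (rbWordModule k X Ω) (rbIdeal X lam)) :
    IsOperatedFilteredHom (forestAlgebra k X Ω) (forestFiltration k X Ω)
      (rbForestAlgebra X lam) (rbForestFiltration k X Ω) (psi lam h) where
  toIsOperatedHom := by
    rw [psi_eq]
    exact (isOperatedHom_wordToRBForest lam).comp isOperatedHom_thetaLin_symm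
  map_filtration n a ha := by
    rw [forestFiltration_eq_comap] at ha
    rw [psi_eq, rbForestFiltration_eq_comap, Submodule.mem_comap, LinearMap.comp_apply,
      rbForestToWord_wordToRBForest]
    exact normalForm_mem_wordFiltration lam ha

theorem isFreeMatchingRotaBaxter_rbForestAlgebra.{r} :
    IsFreeMatchingRotaBaxter.{r} lam (rbForestAlgebra X lam) (dotRB k Ω) := by
  refine ⟨isMatchingRotaBaxter_rbForestAlgebra lam, fun R _ _ P hR f => ?_⟩
  -- The extension of `f` reads a forest as a word and evaluates it in `R`.
  refine ⟨eval (OperatedData.ofAlgebra P) f ∘ₗ rbForestToWord k X Ω, ⟨?_, fun x => ?_⟩, ?_⟩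
  · exact (IsOperatedHom.of_wordAlgebra lam hR (isOperatedHom_eval f hR.toIsOperatedAlgebra)).comp
      (isOperatedHom_rbForestToWord lam)
  · rw [LinearMap.comp_apply, rbForestToWord_dotRB, eval_var f hR.toIsOperatedAlgebra]
  · rintro φ ⟨hφ, hf⟩
    -- Composed with θφ, any candidate becomes a homomorphism on the free operated algebra, hence
    -- equals evaluation at `f`; since θφ has the section θ⁻¹, the candidate itself is determined.
    have h := eq_eval (hφ.comp (isOperatedHom_wordToRBForest lam))
    simp only [LinearMap.comp_apply, wordToRBForest_var, hf] at h
    refine LinearMap.ext fun a => ?_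
    rw [← h, LinearMap.comp_apply, LinearMap.comp_apply, wordToRBForest_rbForestToWord]

end Forests
end MatchingRB

theorem mainTheorem7 (k : Type u) [CommRing k] (X : Type v) (Ω : Type w) [Nonempty Ω]
    (lam : Ω → k) :
    MatchingRB.IsFreeMatchingRotaBaxter.{t} lam
        (MatchingRB.rbForestAlgebra X lam) (MatchingRB.dotRB k Ω) ∧
      MatchingRB.IsOperatedFiltered
        (MatchingRB.rbForestAlgebra X lam) (MatchingRB.rbForestFiltration k X Ω) ∧
      MatchingRB.IsOperatedFiltered
        (MatchingRB.forestAlgebra k X Ω) (MatchingRB.forestFiltration k X Ω) ∧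
      ∃ h : IsCompl (MatchingRB.rbWordModule k X Ω) (MatchingRB.rbIdeal X lam),
        MatchingRB.IsOperatedFilteredHom
          (MatchingRB.forestAlgebra k X Ω) (MatchingRB.forestFiltration k X Ω)
          (MatchingRB.rbForestAlgebra X lam) (MatchingRB.rbForestFiltration k X Ω)
          (MatchingRB.psi lam h) :=
  ⟨MatchingRB.isFreeMatchingRotaBaxter_rbForestAlgebra lam,
    MatchingRB.isOperatedFiltered_rbForestAlgebra lam,
    MatchingRB.isOperatedFiltered_forestAlgebra,
    MatchingRB.isCompl_rbWordModule_rbIdeal lam,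
    MatchingRB.isOperatedFilteredHom_psi lam _⟩
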